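/- Let $A\in M_n(\mathbb R)$ and $B\in M_{n,m}(\mathbb R)$ be constant matrices such that $\operatorname{rank}B=m$ and $(A,B)$ satisfies the Kalman condition (the columns of $B,AB,\dots,A^{n-1}B$ span $\mathbb R^n$). For an autonomous cost $c(x,u)$, the optimal synthesis of $c$ is the set of all trajectories of $\dot x=Ax+Bu$ (with $u\in L^2$), on all intervals $[t_0,t_1]$ with $t_0<t_1$, that minimize $\int_{t_0}^{t_1}c(x(t),u(t))\,dt$ among all trajectories with the same values at $t_0$ and at $t_1$. A canonical cost is a cost $c(x,u)=(u+Kx)^\top R(u+Kx)$ with $R\in M_m(\mathbb R)$ symmetric positive definite, $\det R=1$, and $K\in M_{m,n}(\mathbb R)$ such that every eigenvalue of $A-BK$ has negative real part. The problem defined by $(A,B)$ and this canonical cost admits a product structure if there exist an integer $N>1$ and constant matrices $M\in GL_n(\mathbb R)$, $U\in GL_m(\mathbb R)$ such that $$M^{-1}(A-BK)M=\operatorname{diag}(A_1,\dots,A_N),\quad M^{-1}BU=\operatorname{diag}(B_1,\dots,B_N),\quad U^\top RU=\operatorname{diag}(R_1,\dots,R_N)$$ are block diagonal, with blocks $A_i\in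 M_{n_i}(\mathbb R)$, $B_i\in M_{n_i,m_i}(\mathbb R)$, $R_i\in M_{m_i}(\mathbb R)$, where $1\le m_i\le n_i$, $\sum_i n_i=n$, $\sum_i m_i=m$, each pair $(A_i,B_i)$ satisfies the Kalman condition and each $R_i$ is symmetric positive definite. Let $\Gamma$ be the optimal synthesis of some cost $x^\top Qx+2x^\top Su+u^\top Ru$, where $Q$, $R$ are symmetric, $R$ is positive definite, and the Hamiltonian matrix $$\begin{pmatrix}A-BR^{-1}S^\top & BR^{-1}B^\top\\ Q-SR^{-1}S^\top & -A^\top+SR^{-1}B^\top\end{pmatrix}$$ has no eigenvalue on the imaginary axis. **Theorem.** There exists exactly one canonical cost whose optimal synthesis is $\Gamma$ if and only if $\Gamma$ is not the optimal synthesis of any canonical cost for which the problem defined by $(A,B)$ and that cost admits a product structure. -/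

import Mathlib

open MeasureTheory

namespace LQ

/-- Kalman controllability condition: the columns of `B, A B, …, A ^ (n - 1) B` span `ℝⁿ`. -/
def IsKalman {n m : ℕ} (A : Matrix (Fin n) (Fin n) ℝ) (B : Matrix (Fin n) (Fin m) ℝ) : Prop :=
  Submodule.span ℝ {w : Fin n → ℝ | ∃ k < n, ∃ v : Fin m → ℝ, w = (A ^ k * B).mulVec v} = ⊤

/-- All complex eigenvalues have negative real part. -/
def IsAsymptoticallyStable {n : ℕ} (F : Matrix (Fin n) (Fin n) ℝ) : Prop :=
  ∀ μ ∈ spectrum ℂ (F.map (algebraMap ℝ ℂ)), μ.re < 0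

/-- The Hamiltonian matrix of the LQ problem defined by `(A, B, Q, S, R)`. -/
noncomputable def hamiltonianMatrix {n m : ℕ} (A : Matrix (Fin n) (Fin n) ℝ)
    (B : Matrix (Fin n) (Fin m) ℝ) (Q : Matrix (Fin n) (Fin n) ℝ)
    (S : Matrix (Fin n) (Fin m) ℝ) (R : Matrix (Fin m) (Fin m) ℝ) :
    Matrix (Fin n ⊕ Fin n) (Fin n ⊕ Fin n) ℝ :=
  Matrix.fromBlocks
    (A - B * R⁻¹ * S.transpose) (B * R⁻¹ * B.transpose)
    (Q - S * R⁻¹ * S.transpose) (-A.transpose + S * R⁻¹ * B.transpose)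

/-- The quadratic cost `xᵀ Q x + 2 xᵀ S u + uᵀ R u`. -/
def quadCost {n m : ℕ} (Q : Matrix (Fin n) (Fin n) ℝ) (S : Matrix (Fin n) (Fin m) ℝ)
    (R : Matrix (Fin m) (Fin m) ℝ) (x : Fin n → ℝ) (u : Fin m → ℝ) : ℝ :=
  x ⬝ᵥ Q.mulVec x + 2 * (x ⬝ᵥ S.mulVec u) + u ⬝ᵥ R.mulVec u

/-- The standing assumptions on the matrices `(Q, S, R)` of an autonomous cost: `Q`, `R` symmetric,
`R` positive definite, and no eigenvalue of the Hamiltonian matrix on the imaginary axis. -/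
structure IsAdmissibleCost {n m : ℕ} (A : Matrix (Fin n) (Fin n) ℝ)
    (B : Matrix (Fin n) (Fin m) ℝ) (Q : Matrix (Fin n) (Fin n) ℝ)
    (S : Matrix (Fin n) (Fin m) ℝ) (R : Matrix (Fin m) (Fin m) ℝ) : Prop where
  symm : Q.IsSymm
  posDef : R.PosDef
  hamiltonian : ∀ μ ∈ spectrum ℂ ((hamiltonianMatrix A B Q S R).map (algebraMap ℝ ℂ)), μ.re ≠ 0

/-- `x` is, on `[t₀, t₁]`, the trajectory of `ẋ = A x + B u` associated with the square-integrable
control `u`. -/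
structure IsTrajectory {n m : ℕ} (A : Matrix (Fin n) (Fin n) ℝ) (B : Matrix (Fin n) (Fin m) ℝ)
    (t₀ t₁ : ℝ) (x : ℝ → Fin n → ℝ) (u : ℝ → Fin m → ℝ) : Prop where
  memLp : MemLp u 2 (volume.restrict (Set.Icc t₀ t₁))
  continuousOn : ContinuousOn x (Set.Icc t₀ t₁)
  eq_integral : ∀ t ∈ Set.Icc t₀ t₁,
    x t = x t₀ + ∫ s in t₀..t, (A.mulVec (x s) + B.mulVec (u s))

/-- `x` is, on `[t₀, t₁]`, a trajectory that minimizes `∫ c(x, u)` among all trajectories with the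
same end points. -/
def IsMinimizing {n m : ℕ} (A : Matrix (Fin n) (Fin n) ℝ) (B : Matrix (Fin n) (Fin m) ℝ)
    (c : (Fin n → ℝ) → (Fin m → ℝ) → ℝ) (t₀ t₁ : ℝ) (x : ℝ → Fin n → ℝ) : Prop :=
  ∃ u : ℝ → Fin m → ℝ, IsTrajectory A B t₀ t₁ x u ∧
    ∀ (y : ℝ → Fin n → ℝ) (v : ℝ → Fin m → ℝ), IsTrajectory A B t₀ t₁ y v →
      y t₀ = x t₀ → y t₁ = x t₁ →
      ∫ t in t₀..t₁, c (x t) (u t) ≤ ∫ t in t₀..t₁, c (y t) (v t)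

/-- The optimal synthesis of the dynamics `(A, B)` and the cost `c`: all minimizing trajectories,
for all `t₀ < t₁` and all end points. Membership of `(t₀, t₁, x)` depends only on the restriction
of `x` to `[t₀, t₁]`, so that two syntheses are equal exactly when they consist of the same
trajectories on every interval. -/
def synthesis {n m : ℕ} (A : Matrix (Fin n) (Fin n) ℝ) (B : Matrix (Fin n) (Fin m) ℝ)
    (c : (Fin n → ℝ) → (Fin m → ℝ) → ℝ) : Set (ℝ × ℝ × (ℝ → Fin n → ℝ)) :=
  {p | p.1 < p.2.1 ∧ IsMinimizing A B c p.1 p.2.1 p.2.2}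

/-- `Γ` is the optimal synthesis of some autonomous quadratic cost satisfying the standing
assumptions. -/
def IsLQSynthesis {n m : ℕ} (A : Matrix (Fin n) (Fin n) ℝ) (B : Matrix (Fin n) (Fin m) ℝ)
    (Γ : Set (ℝ × ℝ × (ℝ → Fin n → ℝ))) : Prop :=
  ∃ (Q : Matrix (Fin n) (Fin n) ℝ) (S : Matrix (Fin n) (Fin m) ℝ) (R : Matrix (Fin m) (Fin m) ℝ),
    IsAdmissibleCost A B Q S R ∧ Γ = synthesis A B (quadCost Q S R)

/-- The cost `(u + K x)ᵀ R (u + K x)`. -/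
def feedbackCost {n m : ℕ} (R : Matrix (Fin m) (Fin m) ℝ) (K : Matrix (Fin m) (Fin n) ℝ)
    (x : Fin n → ℝ) (u : Fin m → ℝ) : ℝ :=
  (u + K.mulVec x) ⬝ᵥ R.mulVec (u + K.mulVec x)

/-- The conditions on `(R, K)` under which `(u + K x)ᵀ R (u + K x)` is a canonical cost. -/
structure IsCanonicalPair {n m : ℕ} (A : Matrix (Fin n) (Fin n) ℝ) (B : Matrix (Fin n) (Fin m) ℝ)
    (R : Matrix (Fin m) (Fin m) ℝ) (K : Matrix (Fin m) (Fin n) ℝ) : Prop where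
  posDef : R.PosDef
  det_eq_one : R.det = 1
  stable : IsAsymptoticallyStable (A - B * K)

/-- `c` is a canonical autonomous cost. -/
def IsCanonicalCost {n m : ℕ} (A : Matrix (Fin n) (Fin n) ℝ) (B : Matrix (Fin n) (Fin m) ℝ)
    (c : (Fin n → ℝ) → (Fin m → ℝ) → ℝ) : Prop :=
  ∃ (R : Matrix (Fin m) (Fin m) ℝ) (K : Matrix (Fin m) (Fin n) ℝ),
    IsCanonicalPair A B R K ∧ c = feedbackCost R K

/-- The identification of the disjoint union of `N` consecutive index blocks of sizes `d i` with
`{0, …, n - 1}`, where `n` is the sum of the sizes. -/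
def blockEquiv {N n : ℕ} (d : Fin N → ℕ) (h : ∑ i, d i = n) : ((i : Fin N) × Fin (d i)) ≃ Fin n :=
  finSigmaFinEquiv.trans (finCongr h)

/-- `Ā`, `B̄`, `R̄` are block diagonal with `N` diagonal blocks `Aᵢ` (of size `nᵢ × nᵢ`), `Bᵢ`
(of size `nᵢ × mᵢ`), `Rᵢ` (of size `mᵢ × mᵢ`), where `1 ≤ mᵢ ≤ nᵢ`, `(Aᵢ, Bᵢ)` is controllable
and `Rᵢ` is positive definite. -/
def IsProductForm {n m : ℕ} (N : ℕ) (Abar : Matrix (Fin n) (Fin n) ℝ)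
    (Bbar : Matrix (Fin n) (Fin m) ℝ) (Rbar : Matrix (Fin m) (Fin m) ℝ) : Prop :=
  ∃ (dn dm : Fin N → ℕ) (hn : ∑ i, dn i = n) (hm : ∑ i, dm i = m)
    (Ai : (i : Fin N) → Matrix (Fin (dn i)) (Fin (dn i)) ℝ)
    (Bi : (i : Fin N) → Matrix (Fin (dn i)) (Fin (dm i)) ℝ)
    (Ri : (i : Fin N) → Matrix (Fin (dm i)) (Fin (dm i)) ℝ),
    (∀ i, 0 < dm i ∧ dm i ≤ dn i ∧ IsKalman (Ai i) (Bi i) ∧ (Ri i).PosDef) ∧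
    Abar = Matrix.reindex (blockEquiv dn hn) (blockEquiv dn hn) (Matrix.blockDiagonal' Ai) ∧
    Bbar = Matrix.reindex (blockEquiv dn hn) (blockEquiv dm hm) (Matrix.blockDiagonal' Bi) ∧
    Rbar = Matrix.reindex (blockEquiv dm hm) (blockEquiv dm hm) (Matrix.blockDiagonal' Ri)

/-- The LQ problem defined by `(A, B)` and the cost `(u + K x)ᵀ R (u + K x)` admits an autonomous
product structure: constant linear changes of coordinates `x = M x̄`, `u + K x = U ū` split it into
`N > 1` independent problems. -/
def HasProductStructure {n m : ℕ} (A : Matrix (Fin n) (Fin n) ℝ) (B : Matrix (Fin n) (Fin m) ℝ)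
    (R : Matrix (Fin m) (Fin m) ℝ) (K : Matrix (Fin m) (Fin n) ℝ) : Prop :=
  ∃ (N : ℕ) (M : Matrix.GeneralLinearGroup (Fin n) ℝ) (U : Matrix.GeneralLinearGroup (Fin m) ℝ),
    1 < N ∧
    IsProductForm N
      ((M⁻¹ : Matrix.GeneralLinearGroup (Fin n) ℝ).val * (A - B * K) * M.val)
      ((M⁻¹ : Matrix.GeneralLinearGroup (Fin n) ℝ).val * B * U.val)
      (U.val.transpose * R * U.val)

end LQ

/-! Existence of a canonical cost. The Hamiltonian has no imaginary eigenvalue, so the stable part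
of the phase space is an invariant isotropic subspace; controllability makes it the graph of a
symmetric `P` solving the Riccati equation (`exists_stabilizing_riccati`). Subtracting the exact
derivative of `xᵀ P x` leaves a perfect square in `u + K x` with `A - B K` stable. This changes
costs only by endpoint terms, and scaling `R` gives determinant 1 (`exists_canonicalPair`).

What a synthesis determines. Put `F = A - B K`, let `W` be the Gramian, `F W + W Fᵀ + B R⁻¹ Bᵀ = 0`,
and `G = F + B R⁻¹ Bᵀ W⁻¹ = -W Fᵀ W⁻¹`, which is antistable. Minimizers on `[0, 1]` have the form
`e^{tF} a + e^{tG} b`, and both pure flows are minimizers. Stable and antistable flows are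
independent, so the synthesis determines `F` and `G` (`closedLoop_eq_of_synthesis_eq`).

Two canonical costs with the same synthesis. Equality of `F` gives `K = K'`, as `B` is injective.
With `Δ = R'⁻¹ R` and `D = W' W⁻¹`, equality of `G` gives `D B = B Δ` and `D F = F D`. `Δ` is
diagonalizable over `ℝ`, and not scalar if the costs differ, because both determinants are 1. A
polynomial `f` with `f(Δ)` a nontrivial idempotent has `f(D)` idempotent too, by controllability.
The two idempotents split the problem (`hasProductStructure_of_ne`).

Conversely, a product structure decouples the minimization, so one block of the cost can be
reweighted without changing the minimizers; after normalization this is a different canonical cost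
(`exists_ne_of_hasProductStructure`). -/

namespace LQ

open Polynomial Matrix

/-! ### Real polynomials with roots in one half-plane. -/

/-- All complex roots of the real polynomial `p` have negative real part. -/
def HurwitzPoly (p : ℝ[X]) : Prop := ∀ z : ℂ, aeval z p = 0 → z.re < 0

/-- All complex roots of the real polynomial `p` have positive real part. -/
def AntiHurwitzPoly (p : ℝ[X]) : Prop := ∀ z : ℂ, aeval z p = 0 → 0 < z.re

theorem HurwitzPoly.mul {p q : ℝ[X]} (hp : HurwitzPoly p) (hq : HurwitzPoly q) :
    HurwitzPoly (p * q) := by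
  intro z hz
  rw [map_mul, mul_eq_zero] at hz
  exact hz.elim (hp z) (hq z)

theorem AntiHurwitzPoly.mul {p q : ℝ[X]} (hp : AntiHurwitzPoly p) (hq : AntiHurwitzPoly q) :
    AntiHurwitzPoly (p * q) := by
  intro z hz
  rw [map_mul, mul_eq_zero] at hz
  exact hz.elim (hp z) (hq z)

theorem HurwitzPoly.isCoprime {p q : ℝ[X]} (hp : HurwitzPoly p) (hq : AntiHurwitzPoly q) :
    IsCoprime p q := by
  rw [Polynomial.isCoprime_iff_aeval_ne_zero_of_isAlgClosed ℝ ℂ]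
  intro z
  by_contra! h
  exact absurd (hp z h.1) (hq z h.2).not_gt

theorem HurwitzPoly.comp_neg {p : ℝ[X]} (hp : HurwitzPoly p) : AntiHurwitzPoly (p.comp (-X)) := by
  intro z hz
  rw [aeval_comp] at hz
  have := hp (-z) (by simpa using hz)
  simpa using this

theorem AntiHurwitzPoly.comp_neg {p : ℝ[X]} (hp : AntiHurwitzPoly p) :
    HurwitzPoly (p.comp (-X)) := by
  intro z hz
  rw [aeval_comp] at hz
  have := hp (-z) (by simpa using hz)
  simpa using this

/-- The complex roots of a real irreducible polynomial have the same real part. -/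
theorem re_eq_of_irreducible {q : ℝ[X]} (hq : Irreducible q) {z w : ℂ}
    (hz : aeval z q = 0) (hw : aeval w q = 0) : w.re = z.re := by
  by_cases h : z.im = 0
  · have hzr : z = (z.re : ℂ) := by apply Complex.ext <;> simp [h]
    have hd : (X - C z.re) ∣ q := by
      rw [dvd_iff_isRoot, IsRoot]
      have h2 : aeval ((z.re : ℝ) : ℂ) q = 0 := by rw [← hzr]; exact hz
      have h3 := aeval_algebraMap_apply ℂ z.re q
      rw [Complex.coe_algebraMap, h2] at h3
      simpa using h3.symm
    have ha : Associated (X - C z.re) q := (irreducible_X_sub_C _).associated_of_dvd hq hd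
    obtain ⟨r, hr⟩ := ha.symm.dvd
    have h4 : aeval w (X - C z.re) = 0 := by rw [hr, map_mul, hw, zero_mul]
    have h5 : w = z.re := by
      simpa [sub_eq_zero] using h4
    rw [h5]; simp
  · have hd := quadratic_dvd_of_aeval_eq_zero_im_ne_zero q hz h
    have ha : Associated (X ^ 2 - C (2 * z.re) * X + C (‖z‖ ^ 2)) q := by
      obtain ⟨r, hr⟩ := hd
      rcases hq.isUnit_or_isUnit hr with hu | hu
      · exfalso
        have h1 := natDegree_eq_zero_of_isUnit hu
        have h2 : (X ^ 2 - C (2 * z.re) * X + C (‖z‖ ^ 2)).natDegree = 2 := by compute_degree!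
        omega
      · exact ⟨hu.unit, by rw [hr]; rfl⟩
    obtain ⟨r, hr⟩ := ha.symm.dvd
    have h4 : aeval w (X ^ 2 - C (2 * z.re) * X + C (‖z‖ ^ 2)) = 0 := by
      rw [hr, map_mul, hw, zero_mul]
    have h5 : (w - z) * (w - (starRingEnd ℂ) z) = 0 := by
      have h6 := Complex.mul_conj z
      have h7 := Complex.add_conj z
      have h8 : ((‖z‖ ^ 2 : ℝ) : ℂ) = z * (starRingEnd ℂ) z := by
        rw [h6, Complex.normSq_eq_norm_sq]
      simp only [map_add, map_sub, map_mul, map_pow, aeval_X, aeval_C,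
        Complex.coe_algebraMap] at h4
      have h9 : ((2 : ℝ) : ℂ) * (z.re : ℂ) = z + (starRingEnd ℂ) z := by rw [h7]; push_cast; rfl
      push_cast at h4 h8 h9
      linear_combination h4 + w * h9 - h8
    rcases mul_eq_zero.mp h5 with h6 | h6
    · rw [sub_eq_zero.mp h6]
    · rw [sub_eq_zero.mp h6]; simp

/-- A real polynomial without roots on the imaginary axis is the product of a polynomial with roots
on the left and of a polynomial with roots on the right. -/
theorem exists_hurwitz_mul_antiHurwitz (p : ℝ[X]) (hp : ∀ z : ℂ, aeval z p = 0 → z.re ≠ 0) :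
    ∃ q r : ℝ[X], HurwitzPoly q ∧ AntiHurwitzPoly r ∧ p = q * r := by
  induction p using WfDvdMonoid.induction_on_irreducible with
  | zero => exact absurd rfl (hp 0 (by simp))
  | unit u hu =>
    refine ⟨u, 1, ?_, ?_, by simp⟩
    · intro z hz
      have := (hu.map (aeval z)).ne_zero
      exact absurd hz this
    · intro z hz
      simp at hz
  | mul a i ha hi ih =>
    obtain ⟨q, r, hq, hr, rfl⟩ := ih (fun z hz => hp z (by rw [map_mul, hz, mul_zero]))
    obtain ⟨z, hz⟩ : ∃ z : ℂ, aeval z i = 0 :=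
      IsAlgClosed.exists_aeval_eq_zero _ i (degree_pos_of_irreducible hi).ne'
    have hz0 := hp z (by rw [map_mul, hz, zero_mul])
    rcases lt_or_gt_of_ne hz0 with h | h
    · refine ⟨i * q, r, HurwitzPoly.mul ?_ hq, hr, by ring⟩
      intro w hw
      rw [re_eq_of_irreducible hi hz hw]; exact h
    · refine ⟨q, i * r, hq, AntiHurwitzPoly.mul ?_ hr, by ring⟩
      intro w hw
      rw [re_eq_of_irreducible hi hz hw]; exact h

/-! ### Polynomials of matrices. -/

section MatrixPoly

variable {ι κ : Type*} [Fintype ι] [DecidableEq ι] [Fintype κ] [DecidableEq κ]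

theorem mem_spectrum_map_iff (F : Matrix ι ι ℝ) (z : ℂ) :
    z ∈ spectrum ℂ (F.map (algebraMap ℝ ℂ)) ↔ aeval z F.charpoly = 0 := by
  rw [Matrix.mem_spectrum_iff_isRoot_charpoly, Matrix.charpoly_map, IsRoot, eval_map_algebraMap]

theorem aeval_transpose (F : Matrix ι ι ℝ) (p : ℝ[X]) : aeval Fᵀ p = (aeval F p)ᵀ := by
  induction p using Polynomial.induction_on' with
  | add p q hp hq => simp [hp, hq]
  | monomial k a => simp [aeval_monomial, Algebra.algebraMap_eq_smul_one, Matrix.transpose_pow]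

theorem aeval_neg_comp (F : Matrix ι ι ℝ) (p : ℝ[X]) :
    aeval (-F) p = aeval F (p.comp (-X)) := by
  rw [aeval_comp]; simp

/-- `X` may be rectangular: the relation is later applied to `B` and to the parametrization of an
invariant graph. -/
theorem aeval_mul_comm_of_comm {F : Matrix ι ι ℝ} {G : Matrix κ κ ℝ} {X : Matrix ι κ ℝ}
    (h : F * X = X * G) (p : ℝ[X]) : aeval F p * X = X * aeval G p := by
  have hk : ∀ k : ℕ, F ^ k * X = X * G ^ k := by
    intro k
    induction k with
    | zero => simp
    | succ k ih => rw [pow_succ, Matrix.mul_assoc, h, ← Matrix.mul_assoc, ih, Matrix.mul_assoc,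
        ← pow_succ]
  induction p using Polynomial.induction_on' with
  | add p q hp hq => simp [hp, hq, Matrix.add_mul, Matrix.mul_add]
  | monomial k a => simp [aeval_monomial, Algebra.algebraMap_eq_smul_one, hk]

theorem eq_zero_of_aeval_mulVec {F : Matrix ι ι ℝ} {p q : ℝ[X]} (h : IsCoprime p q)
    {v : ι → ℝ} (hp : aeval F p *ᵥ v = 0) (hq : aeval F q *ᵥ v = 0) : v = 0 := by
  obtain ⟨a, b, hab⟩ := h
  have h1 : aeval F (a * p + b * q) *ᵥ v = 0 := by
    rw [map_add, map_mul, map_mul, Matrix.add_mulVec, ← Matrix.mulVec_mulVec,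
      ← Matrix.mulVec_mulVec, hp, hq]
    simp
  rwa [hab, map_one, Matrix.one_mulVec] at h1

end MatrixPoly

/-! ### Stable and antistable matrices, Sylvester equation. -/

/-- `F` is annihilated by a polynomial with roots in the open left half-plane. -/
def Stable {n : ℕ} (F : Matrix (Fin n) (Fin n) ℝ) : Prop := ∃ p, HurwitzPoly p ∧ aeval F p = 0

/-- `F` is annihilated by a polynomial with roots in the open right half-plane. -/
def Antistable {n : ℕ} (F : Matrix (Fin n) (Fin n) ℝ) : Prop :=
  ∃ p, AntiHurwitzPoly p ∧ aeval F p = 0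

/-- Cayley–Hamilton one way, spectral mapping the other. Annihilating polynomials allow later
arguments to use Bézout identities over `ℝ` instead of complex eigenvectors. -/
theorem isAsymptoticallyStable_iff {n : ℕ} (F : Matrix (Fin n) (Fin n) ℝ) :
    IsAsymptoticallyStable F ↔ Stable F := by
  constructor
  · intro h
    exact ⟨F.charpoly, fun z hz => h z ((mem_spectrum_map_iff F z).mpr hz),
      Matrix.aeval_self_charpoly F⟩
  · rintro ⟨p, hp, hF⟩ z hz
    apply hp
    have h1 := spectrum.subset_polynomial_aeval (F.map (algebraMap ℝ ℂ))
      (p.map (algebraMap ℝ ℂ)) ⟨z, hz, rfl⟩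
    have h2 : aeval (F.map (algebraMap ℝ ℂ)) (p.map (algebraMap ℝ ℂ)) = 0 := by
      have h3 := map_aeval_eq_aeval_map (S := Matrix (Fin n) (Fin n) ℝ)
        (φ := algebraMap ℝ ℂ) (ψ := (algebraMap ℝ ℂ).mapMatrix) (by
          ext a i j
          simp [Matrix.algebraMap_matrix_apply]
          split_ifs <;> simp) p F
      rw [hF, map_zero] at h3
      exact h3.symm
    have : Nontrivial (Matrix (Fin n) (Fin n) ℂ) := by
      rcases n with _ | n
      · exfalso
        have : Subsingleton (Matrix (Fin 0) (Fin 0) ℂ) := inferInstance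
        simp [spectrum.of_subsingleton] at hz
      · infer_instance
    rw [h2, spectrum.zero_eq] at h1
    simpa [eval_map_algebraMap] using h1

theorem Stable.transpose {n : ℕ} {F : Matrix (Fin n) (Fin n) ℝ} (h : Stable F) : Stable Fᵀ := by
  obtain ⟨p, hp, hF⟩ := h
  exact ⟨p, hp, by rw [aeval_transpose, hF, Matrix.transpose_zero]⟩

theorem Stable.neg {n : ℕ} {F : Matrix (Fin n) (Fin n) ℝ} (h : Stable F) : Antistable (-F) := by
  obtain ⟨p, hp, hF⟩ := h
  refine ⟨p.comp (-X), hp.comp_neg, ?_⟩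
  rw [← aeval_neg_comp, neg_neg, hF]

theorem Antistable.conj {n : ℕ} {F G X : Matrix (Fin n) (Fin n) ℝ} (h : Antistable F)
    (hX : IsUnit X) (hc : G * X = X * F) : Antistable G := by
  obtain ⟨p, hp, hF⟩ := h
  refine ⟨p, hp, ?_⟩
  have := aeval_mul_comm_of_comm hc p
  rw [hF, mul_zero] at this
  exact (hX.mul_left_eq_zero).mp this

/-- The Sylvester equation `F X - X G = C` with `F` stable and `G` antistable. -/
theorem existsUnique_sylvester {n : ℕ} {F G : Matrix (Fin n) (Fin n) ℝ} (hF : Stable F)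
    (hG : Antistable G) (C : Matrix (Fin n) (Fin n) ℝ) : ∃! X, F * X - X * G = C := by
  let T : Matrix (Fin n) (Fin n) ℝ →ₗ[ℝ] Matrix (Fin n) (Fin n) ℝ :=
    LinearMap.mulLeft ℝ F - LinearMap.mulRight ℝ G
  -- If `F X = X G`, then `p(F) X = 0` and `q(F) X = X q(G) = 0`, so `X = 0` by Bézout. Surjectivity
  -- follows by dimension.
  have hT : Function.Injective T := by
    rw [← LinearMap.ker_eq_bot, LinearMap.ker_eq_bot']
    intro X hX
    have hX' : F * X = X * G := by simpa [T, sub_eq_zero] using hX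
    obtain ⟨p, hp, hpF⟩ := hF
    obtain ⟨q, hq, hqG⟩ := hG
    have h1 := aeval_mul_comm_of_comm hX' p
    have h2 := aeval_mul_comm_of_comm hX' q
    rw [hpF, zero_mul] at h1
    rw [hqG, mul_zero] at h2
    obtain ⟨a, b, hab⟩ := hp.isCoprime hq
    have h3 : aeval F (a * p + b * q) * X = 0 := by
      rw [map_add, map_mul, map_mul, hpF, mul_zero, zero_add, Matrix.mul_assoc, h2, mul_zero]
    rwa [hab, map_one, one_mul] at h3
  have hT' := LinearMap.injective_iff_surjective.mp hT
  obtain ⟨X, hX⟩ := hT' C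
  refine ⟨X, by simpa [T] using hX, fun Y hY => hT ?_⟩
  rw [hX]; simpa [T] using hY

/-! ### Controllability. -/

section Kalman

variable {n m : ℕ} {A : Matrix (Fin n) (Fin n) ℝ} {B : Matrix (Fin n) (Fin m) ℝ}

theorem pow_mem_span_of_kalman (A : Matrix (Fin n) (Fin n) ℝ) (k : ℕ) :
    A ^ k ∈ Submodule.span ℝ ((fun j => A ^ j) '' Set.Iio n) := by
  rcases Nat.eq_zero_or_pos n with rfl | hn
  · rw [Subsingleton.elim (A ^ k) 0]; exact zero_mem _
  · rw [Matrix.pow_eq_aeval_mod_charpoly]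
    have hd : (X ^ k %ₘ A.charpoly).natDegree < n := by
      have h1 := natDegree_modByMonic_lt (X ^ k) A.charpoly_monic (by
        intro h
        have h2 := A.charpoly_natDegree_eq_dim
        rw [h] at h2
        simp at h2; omega)
      rwa [A.charpoly_natDegree_eq_dim, Fintype.card_fin] at h1
    rw [aeval_eq_sum_range' hd]
    refine Submodule.sum_mem _ fun j hj => Submodule.smul_mem _ _ (Submodule.subset_span ?_)
    exact ⟨j, Finset.mem_range.mp hj, rfl⟩

/-- Dual form of the rank condition. By Cayley–Hamilton the bound `k < n` can be dropped, which
makes arguments with invariant subspaces possible. -/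
theorem isKalman_iff : IsKalman A B ↔
    ∀ p : Fin n → ℝ, (∀ k : ℕ, Bᵀ *ᵥ ((Aᵀ) ^ k *ᵥ p) = 0) → p = 0 := by
  have key : ∀ (p : Fin n → ℝ) (k : ℕ) (v : Fin m → ℝ),
      p ⬝ᵥ (A ^ k * B) *ᵥ v = (Bᵀ *ᵥ ((Aᵀ) ^ k *ᵥ p)) ⬝ᵥ v := by
    intro p k v
    rw [Matrix.mulVec_mulVec, Matrix.dotProduct_mulVec, ← Matrix.mulVec_transpose,
      Matrix.transpose_mul, Matrix.transpose_pow]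
  constructor
  · intro h p hp
    have h1 : p ∈ Submodule.span ℝ {w : Fin n → ℝ | ∃ k < n, ∃ v : Fin m → ℝ,
        w = (A ^ k * B).mulVec v} := by
      rw [IsKalman] at h
      rw [h]; trivial
    have h2 : ∀ w ∈ Submodule.span ℝ {w : Fin n → ℝ | ∃ k < n, ∃ v : Fin m → ℝ,
        w = (A ^ k * B).mulVec v}, p ⬝ᵥ w = 0 := by
      intro w hw
      induction hw using Submodule.span_induction with
      | mem w hw =>
        obtain ⟨k, -, v, rfl⟩ := hw
        rw [key, hp k, zero_dotProduct]
      | zero => simp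
      | add x y _ _ hx hy => rw [dotProduct_add, hx, hy, add_zero]
      | smul a x _ hx => rw [dotProduct_smul, hx, smul_zero]
    exact dotProduct_self_eq_zero.mp (h2 p h1)
  · intro h
    by_contra hne
    obtain ⟨f, hf0, hf⟩ := Submodule.exists_le_ker_of_lt_top _ (lt_top_iff_ne_top.mpr hne)
    apply hf0
    let p : Fin n → ℝ := fun i => f (Pi.single i 1)
    have hp : ∀ w, f w = p ⬝ᵥ w := by
      intro w
      rw [LinearMap.pi_apply_eq_sum_univ f w, dotProduct]
      refine Finset.sum_congr rfl fun i _ => ?_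
      have : (fun j => if i = j then (1 : ℝ) else 0) = Pi.single i 1 := by
        ext j; simp [Pi.single_apply, eq_comm]
      rw [this, smul_eq_mul, mul_comm]
    have h0 : p = 0 := by
      apply h
      intro k
      apply dotProduct_self_eq_zero.mp
      set v := Bᵀ *ᵥ ((Aᵀ) ^ k *ᵥ p)
      rw [← key]
      have h1 : ∀ M ∈ Submodule.span ℝ ((fun j => A ^ j) '' Set.Iio n),
          p ⬝ᵥ (M * B) *ᵥ v = 0 := by
        intro M hM
        induction hM using Submodule.span_induction with
        | mem M hM =>
          obtain ⟨j, hj, rfl⟩ := hM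
          rw [← hp]
          exact hf (Submodule.subset_span ⟨j, hj, v, rfl⟩)
        | zero => simp
        | add x y _ _ hx hy => rw [Matrix.add_mul, Matrix.add_mulVec, dotProduct_add, hx, hy,
            add_zero]
        | smul a x _ hx => rw [Matrix.smul_mul, Matrix.smul_mulVec, dotProduct_smul, hx,
            smul_zero]
      exact h1 _ (pow_mem_span_of_kalman A k)
    ext w
    simp [hp, h0]

/-- The form in which controllability is mostly used: `V` will be the vertical part of an isotropic
subspace, the kernel of the Gramian, or the range of a transposed matrix. -/
theorem IsKalman.eq_zero (h : IsKalman A B) (V : Submodule ℝ (Fin n → ℝ))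
    (hB : ∀ p ∈ V, Bᵀ *ᵥ p = 0) (hA : ∀ p ∈ V, Aᵀ *ᵥ p ∈ V) {p : Fin n → ℝ} (hp : p ∈ V) :
    p = 0 := by
  refine isKalman_iff.mp h p fun k => hB _ ?_
  induction k with
  | zero => simpa using hp
  | succ k ih => rw [pow_succ', ← Matrix.mulVec_mulVec]; exact hA _ ih

/-- On a vector killed by every `Bᵀ ((A - B K)ᵀ)^k`, the powers of `Aᵀ` and `(A - B K)ᵀ` agree,
since the terms through `Kᵀ Bᵀ` vanish. -/
theorem IsKalman.sub_mul (h : IsKalman A B) (K : Matrix (Fin m) (Fin n) ℝ) :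
    IsKalman (A - B * K) B := by
  rw [isKalman_iff] at h ⊢
  intro p hp
  apply h
  have : ∀ k : ℕ, (Aᵀ) ^ k *ᵥ p = ((A - B * K)ᵀ) ^ k *ᵥ p := by
    intro k
    induction k with
    | zero => simp
    | succ k ih =>
      rw [pow_succ', pow_succ', ← Matrix.mulVec_mulVec, ← Matrix.mulVec_mulVec, ih,
        show (A - B * K)ᵀ = Aᵀ - Kᵀ * Bᵀ by rw [Matrix.transpose_sub, Matrix.transpose_mul],
        Matrix.sub_mulVec, ← Matrix.mulVec_mulVec _ Kᵀ]
      have := hp k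
      rw [Matrix.transpose_sub, Matrix.transpose_mul] at this
      rw [this, Matrix.mulVec_zero, sub_zero]
  intro k
  rw [this, hp]

end Kalman

/-! ### Lagrangian subspaces and the stabilizing Riccati solution. -/

section Riccati

variable {n m : ℕ}

/-- The subspace annihilated by `p(H)` is isotropic when `p(X)` and `p(-X)` are coprime and `H` is
Hamiltonian. -/
theorem isotropic_of_isCoprime {ι : Type*} [Fintype ι] [DecidableEq ι] {H J : Matrix ι ι ℝ}
    (hJ : -Hᵀ * J = J * H) {p : ℝ[X]} (hp : IsCoprime p (p.comp (-X))) {x y : ι → ℝ}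
    (hx : aeval H p *ᵥ x = 0) (hy : aeval H p *ᵥ y = 0) : x ⬝ᵥ J *ᵥ y = 0 := by
  obtain ⟨a, b, hab⟩ := hp
  -- Bézout puts `x` in the image of `p(-H)`; moved across the form, this factor becomes `J p(H) y =
  -- 0`.
  have h1 : x = aeval H (p.comp (-X)) *ᵥ (aeval H b *ᵥ x) := by
    have h2 : aeval H (a * p + p.comp (-X) * b) *ᵥ x = x := by
      rw [mul_comm _ b, hab, map_one, Matrix.one_mulVec]
    rw [map_add, map_mul, map_mul, Matrix.add_mulVec, ← Matrix.mulVec_mulVec, hx,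
      Matrix.mulVec_zero, zero_add, ← Matrix.mulVec_mulVec] at h2
    exact h2.symm
  have h3 : (aeval H (p.comp (-X)))ᵀ *ᵥ (J *ᵥ y) = 0 := by
    rw [← aeval_transpose, ← aeval_neg_comp, Matrix.mulVec_mulVec, aeval_mul_comm_of_comm hJ,
      ← Matrix.mulVec_mulVec, hy, Matrix.mulVec_zero]
  rw [h1, dotProduct_comm, Matrix.dotProduct_mulVec, ← Matrix.mulVec_transpose, h3,
    zero_dotProduct]

/-- The standard symplectic matrix. -/
def symplecticForm (n : ℕ) : Matrix (Fin n ⊕ Fin n) (Fin n ⊕ Fin n) ℝ := fromBlocks 0 1 (-1) 0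

theorem dotProduct_symplecticForm (a b c d : Fin n → ℝ) :
    Sum.elim a b ⬝ᵥ symplecticForm n *ᵥ Sum.elim c d = a ⬝ᵥ d - b ⬝ᵥ c := by
  rw [symplecticForm, Matrix.fromBlocks_mulVec]
  simp [Matrix.neg_mulVec, sub_eq_add_neg]

theorem hamiltonian_symplecticForm {A N Q : Matrix (Fin n) (Fin n) ℝ} (hN : Nᵀ = N)
    (hQ : Qᵀ = Q) :
    -(fromBlocks A N Q (-Aᵀ))ᵀ * symplecticForm n =
      symplecticForm n * fromBlocks A N Q (-Aᵀ) := by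
  simp [symplecticForm, Matrix.fromBlocks_transpose, Matrix.fromBlocks_multiply,
    Matrix.fromBlocks_neg, hN, hQ]

theorem mulVec_eq_zero_of_posDef {B : Matrix (Fin n) (Fin m) ℝ} {R : Matrix (Fin m) (Fin m) ℝ}
    (hR : R.PosDef) {p : Fin n → ℝ} (h : p ⬝ᵥ (B * R⁻¹ * Bᵀ) *ᵥ p = 0) : Bᵀ *ᵥ p = 0 := by
  by_contra hne
  have h1 := hR.inv.dotProduct_mulVec_pos hne
  have h2 : p ⬝ᵥ (B * R⁻¹ * Bᵀ) *ᵥ p = (Bᵀ *ᵥ p) ⬝ᵥ R⁻¹ *ᵥ (Bᵀ *ᵥ p) := by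
    rw [← Matrix.mulVec_mulVec, ← Matrix.mulVec_mulVec, Matrix.dotProduct_mulVec,
      ← Matrix.mulVec_transpose]
  rw [star_trivial, ← h2, h] at h1
  exact lt_irrefl _ h1

/-- An invariant isotropic subspace of the Hamiltonian matrix meets `0 × ℝⁿ` trivially. -/
theorem eq_zero_of_inr_mem {A Q : Matrix (Fin n) (Fin n) ℝ} {B : Matrix (Fin n) (Fin m) ℝ}
    {R : Matrix (Fin m) (Fin m) ℝ} (hAB : IsKalman A B) (hR : R.PosDef)
    (L : Submodule ℝ (Fin n ⊕ Fin n → ℝ))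
    (hinv : ∀ v ∈ L, fromBlocks A (B * R⁻¹ * Bᵀ) Q (-Aᵀ) *ᵥ v ∈ L)
    (hiso : ∀ v ∈ L, ∀ w ∈ L, v ⬝ᵥ symplecticForm n *ᵥ w = 0) {p : Fin n → ℝ}
    (hp : Sum.elim (0 : Fin n → ℝ) p ∈ L) : p = 0 := by
  have hH : ∀ p : Fin n → ℝ, fromBlocks A (B * R⁻¹ * Bᵀ) Q (-Aᵀ) *ᵥ Sum.elim 0 p =
      Sum.elim ((B * R⁻¹ * Bᵀ) *ᵥ p) (-(Aᵀ *ᵥ p)) := by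
    intro p
    rw [Matrix.fromBlocks_mulVec]
    simp [Matrix.neg_mulVec]
  -- Isotropy of `(0, p)` and its image under the Hamiltonian reads `pᵀ B R⁻¹ Bᵀ p = 0`. Then `Bᵀ p
  -- = 0`, so the image is `(0, -Aᵀ p)` and the vertical part is `Aᵀ`-invariant.
  have hB : ∀ p : Fin n → ℝ, Sum.elim (0 : Fin n → ℝ) p ∈ L → Bᵀ *ᵥ p = 0 := by
    intro p hp
    have h1 := hiso _ hp _ (hinv _ hp)
    rw [hH, dotProduct_symplecticForm, zero_dotProduct, zero_sub, neg_eq_zero] at h1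
    exact mulVec_eq_zero_of_posDef hR h1
  let ι : (Fin n → ℝ) →ₗ[ℝ] (Fin n ⊕ Fin n → ℝ) :=
    { toFun := fun p => Sum.elim (0 : Fin n → ℝ) p
      map_add' := fun x y => by ext (i | i) <;> simp
      map_smul' := fun a x => by ext (i | i) <;> simp }
  refine hAB.eq_zero (L.comap ι) (fun p hp => hB p hp) (fun p hp => ?_) (p := p) hp
  have h2 := hinv _ hp
  change fromBlocks A (B * R⁻¹ * Bᵀ) Q (-Aᵀ) *ᵥ Sum.elim (0 : Fin n → ℝ) p ∈ L at h2
  rw [hH, ← Matrix.mulVec_mulVec, hB p hp, Matrix.mulVec_zero] at h2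
  have h3 := L.neg_mem h2
  change Sum.elim (0 : Fin n → ℝ) (Aᵀ *ᵥ p) ∈ L
  convert h3 using 1
  ext (i | i) <;> simp

/-- `ker p(H)` and `ker q(H)` are isotropic and together span `ℝ²ⁿ`. Each injects into the state
space, so each has dimension `n`, and the first is the graph of some `P`. Isotropy of the graph is
symmetry of `P`; invariance is the Riccati equation. -/
theorem exists_stabilizing_riccati {A Q : Matrix (Fin n) (Fin n) ℝ}
    {B : Matrix (Fin n) (Fin m) ℝ} {R : Matrix (Fin m) (Fin m) ℝ} (hAB : IsKalman A B)
    (hR : R.PosDef) (hQ : Qᵀ = Q) {p q : ℝ[X]} (hp : HurwitzPoly p) (hq : AntiHurwitzPoly q)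
    (hH : aeval (fromBlocks A (B * R⁻¹ * Bᵀ) Q (-Aᵀ)) (p * q) = 0) :
    ∃ P : Matrix (Fin n) (Fin n) ℝ, Pᵀ = P ∧
      Q = P * A + Aᵀ * P + P * (B * R⁻¹ * Bᵀ) * P ∧ Stable (A + B * R⁻¹ * Bᵀ * P) := by
  have hRt : R⁻¹ᵀ = R⁻¹ := by
    have := hR.inv.isHermitian
    simpa [Matrix.IsHermitian, Matrix.conjTranspose_eq_transpose_of_trivial] using this
  set N := B * R⁻¹ * Bᵀ with hNdef
  have hN : Nᵀ = N := by
    rw [hNdef, Matrix.transpose_mul, Matrix.transpose_mul, Matrix.transpose_transpose, hRt,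
      Matrix.mul_assoc]
  set H := fromBlocks A N Q (-Aᵀ) with hHdef
  have hJ := hamiltonian_symplecticForm (A := A) hN hQ
  rw [← hHdef] at hJ
  let L : ℝ[X] → Submodule ℝ (Fin n ⊕ Fin n → ℝ) := fun f => LinearMap.ker (aeval H f).mulVecLin
  have hL : ∀ f v, v ∈ L f ↔ aeval H f *ᵥ v = 0 := fun f v => Iff.rfl
  have hinv : ∀ f, ∀ v ∈ L f, H *ᵥ v ∈ L f := by
    intro f v hv
    have h1 : aeval H f * H = H * aeval H f := by
      have := (Polynomial.commute_X f).map (aeval H)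
      rw [aeval_X] at this
      exact this.symm.eq
    rw [hL] at hv ⊢
    rw [Matrix.mulVec_mulVec, h1, ← Matrix.mulVec_mulVec, hv, Matrix.mulVec_zero]
  have hisop : ∀ v ∈ L p, ∀ w ∈ L p, v ⬝ᵥ symplecticForm n *ᵥ w = 0 := fun v hv w hw =>
    isotropic_of_isCoprime hJ (hp.isCoprime hp.comp_neg) hv hw
  have hisoq : ∀ v ∈ L q, ∀ w ∈ L q, v ⬝ᵥ symplecticForm n *ᵥ w = 0 := fun v hv w hw =>
    isotropic_of_isCoprime hJ (hq.comp_neg.isCoprime hq).symm hv hw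
  let π : (Fin n ⊕ Fin n → ℝ) →ₗ[ℝ] (Fin n → ℝ) := LinearMap.funLeft ℝ ℝ Sum.inl
  have hπ : ∀ f, (∀ v ∈ L f, ∀ w ∈ L f, v ⬝ᵥ symplecticForm n *ᵥ w = 0) →
      Function.Injective (π ∘ₗ (L f).subtype) := by
    intro f hf
    rw [← LinearMap.ker_eq_bot, LinearMap.ker_eq_bot']
    rintro ⟨v, hv⟩ hv0
    have h1 : v = Sum.elim (0 : Fin n → ℝ) (v ∘ Sum.inr) := by
      ext (i | i)
      · exact congrFun hv0 i
      · rfl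
    have h2 : v ∘ Sum.inr = 0 := by
      apply eq_zero_of_inr_mem hAB hR (L f) (hinv f) hf
      rw [← h1]; exact hv
    rw [h2] at h1
    ext i
    change v i = 0
    rw [h1]; rcases i with i | i <;> rfl
  have hsup : L p ⊔ L q = ⊤ := by
    rw [eq_top_iff]
    intro v _
    obtain ⟨a, b, hab⟩ := hp.isCoprime hq
    have h1 : v = aeval H (b * q) *ᵥ v + aeval H (a * p) *ᵥ v := by
      rw [← Matrix.add_mulVec, ← map_add, add_comm, hab, map_one, Matrix.one_mulVec]
    rw [h1]
    refine Submodule.add_mem_sup ?_ ?_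
    · rw [hL, Matrix.mulVec_mulVec, ← map_mul, show p * (b * q) = b * (p * q) by ring, map_mul,
        hH, mul_zero, Matrix.zero_mulVec]
    · rw [hL, Matrix.mulVec_mulVec, ← map_mul, show q * (a * p) = a * (p * q) by ring, map_mul,
        hH, mul_zero, Matrix.zero_mulVec]
  have hdim : Module.finrank ℝ (L p) = Module.finrank ℝ (Fin n → ℝ) := by
    have h1 := LinearMap.finrank_le_finrank_of_injective (hπ p hisop)
    have h2 := LinearMap.finrank_le_finrank_of_injective (hπ q hisoq)
    have h3 := Submodule.finrank_add_le_finrank_add_finrank (L p) (L q)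
    rw [hsup, finrank_top] at h3
    simp only [Module.finrank_fintype_fun_eq_card, Fintype.card_sum, Fintype.card_fin] at *
    omega
  let e : L p ≃ₗ[ℝ] (Fin n → ℝ) := LinearEquiv.ofBijective (π ∘ₗ (L p).subtype)
    ⟨hπ p hisop, (LinearMap.injective_iff_surjective_of_finrank_eq_finrank hdim).mp (hπ p hisop)⟩
  let P : Matrix (Fin n) (Fin n) ℝ := LinearMap.toMatrix'
    (LinearMap.funLeft ℝ ℝ Sum.inr ∘ₗ (L p).subtype ∘ₗ e.symm.toLinearMap)
  have hPm : ∀ x, Sum.elim x (P *ᵥ x) ∈ L p := by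
    intro x
    have h1 : P *ᵥ x = (e.symm x : Fin n ⊕ Fin n → ℝ) ∘ Sum.inr := by
      rw [LinearMap.toMatrix'_mulVec]; rfl
    have h2 : (e.symm x : Fin n ⊕ Fin n → ℝ) ∘ Sum.inl = x := e.apply_symm_apply x
    have h3 : Sum.elim x (P *ᵥ x) = (e.symm x : Fin n ⊕ Fin n → ℝ) := by
      rw [h1]; nth_rewrite 1 [← h2]
      exact Sum.elim_comp_inl_inr _
    rw [h3]; exact (e.symm x).2
  have hPu : ∀ x y, Sum.elim x y ∈ L p → y = P *ᵥ x := by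
    intro x y hxy
    have h1 := (L p).sub_mem hxy (hPm x)
    have h2 : (⟨_, h1⟩ : L p) = 0 := by
      apply hπ p hisop
      ext i
      simp [π, LinearMap.funLeft]
    have h3 := congrArg Subtype.val h2
    ext i
    have := congrFun h3 (Sum.inr i)
    simpa [sub_eq_zero] using this
  have hHm : ∀ x, H *ᵥ Sum.elim x (P *ᵥ x) =
      Sum.elim ((A + N * P) *ᵥ x) ((Q - Aᵀ * P) *ᵥ x) := by
    intro x
    rw [hHdef, Matrix.fromBlocks_mulVec]
    simp [Matrix.add_mulVec, Matrix.neg_mulVec, sub_eq_add_neg, ← Matrix.mulVec_mulVec]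
  have hric : Q - Aᵀ * P = P * (A + N * P) := by
    apply Matrix.ext_of_mulVec_single
    intro i
    rw [← Matrix.mulVec_mulVec]
    apply hPu
    rw [← hHm]
    exact hinv p _ (hPm _)
  have hsymm : Pᵀ = P := by
    apply Matrix.ext_of_mulVec_single
    intro i
    apply dotProduct_eq
    intro y
    have h1 := hisop _ (hPm (Pi.single i 1)) _ (hPm y)
    rw [dotProduct_symplecticForm, sub_eq_zero] at h1
    rw [← h1, Matrix.mulVec_transpose, ← Matrix.dotProduct_mulVec]
  refine ⟨P, hsymm, ?_, p, hp, ?_⟩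
  · rw [sub_eq_iff_eq_add] at hric
    rw [hric, Matrix.mul_add, ← Matrix.mul_assoc]
    abel
  -- `E` parametrizes the graph and intertwines `H` with the closed loop; as `p(H) E = 0`, the upper
  -- block of `E p(A + N P)` vanishes.
  · let E : Matrix (Fin n ⊕ Fin n) (Fin n) ℝ := fromRows 1 P
    have hc : H * E = E * (A + N * P) := by
      rw [hHdef, Matrix.fromBlocks_mul_fromRows, Matrix.fromRows_mul, ← hric]
      simp [sub_eq_add_neg]
    have h1 := aeval_mul_comm_of_comm hc p
    have h2 : aeval H p * E = 0 := by
      apply Matrix.ext_of_mulVec_single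
      intro i
      rw [← Matrix.mulVec_mulVec, Matrix.fromRows_mulVec, Matrix.one_mulVec, Matrix.zero_mulVec]
      exact hPm _
    rw [h2, Matrix.fromRows_mul, one_mul] at h1
    ext i j
    have := congrFun (congrFun h1 (Sum.inl i)) j
    simpa using this.symm

end Riccati

/-! ### Integration by parts and square-integrability. -/

section Calculus

variable {n m : ℕ}

/-- The densities are only integrable, so the product rule is the one for absolutely continuous
functions. -/
theorem integral_mul_deriv_of_eq_integral {a b : ℝ} (hab : a ≤ b) {x y f g : ℝ → ℝ}
    (hf : IntervalIntegrable f volume a b) (hg : IntervalIntegrable g volume a b)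
    (hx : ∀ t ∈ Set.Icc a b, x t = x a + ∫ s in a..t, f s)
    (hy : ∀ t ∈ Set.Icc a b, y t = y a + ∫ s in a..t, g s) :
    ∫ t in a..b, (f t * y t + x t * g t) = x b * y b - x a * y a := by
  have hu : Set.uIcc a b = Set.Icc a b := Set.uIcc_of_le hab
  have hmem : a ∈ Set.uIcc a b := Set.left_mem_uIcc
  have ac : ∀ (c : ℝ) {h : ℝ → ℝ}, IntervalIntegrable h volume a b →
      AbsolutelyContinuousOnInterval (fun t => c + ∫ s in a..t, h s) a b := fun c h hh =>
    ((LipschitzWith.const c).lipschitzOnWith.absolutelyContinuousOnInterval).add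
      (hh.absolutelyContinuousOnInterval_intervalIntegral hmem)
  have h1 := (ac (x a) hf).integral_deriv_mul_eq_sub (ac (y a) hg)
  have hb : b ∈ Set.Icc a b := Set.right_mem_Icc.mpr hab
  simp only [intervalIntegral.integral_same, add_zero, ← hx b hb, ← hy b hb] at h1
  rw [← h1]
  apply intervalIntegral.integral_congr_ae
  filter_upwards [hf.ae_hasDerivAt_integral, hg.ae_hasDerivAt_integral] with t ht1 ht2 ht
  have ht' : t ∈ Set.uIcc a b := Set.uIoc_subset_uIcc ht
  rw [((ht1 ht' a hmem).const_add (x a)).deriv, ((ht2 ht' a hmem).const_add (y a)).deriv,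
    ← hx t (hu ▸ ht'), ← hy t (hu ▸ ht')]

theorem intervalIntegral_apply {a b : ℝ} {f : ℝ → Fin n → ℝ}
    (hf : IntervalIntegrable f volume a b) (i : Fin n) :
    (∫ t in a..b, f t) i = ∫ t in a..b, f t i :=
  ((ContinuousLinearMap.proj (R := ℝ) (φ := fun _ : Fin n => ℝ) i).intervalIntegral_comp_comm
    hf).symm

theorem IntervalIntegrable.apply {a b : ℝ} {f : ℝ → Fin n → ℝ}
    (hf : IntervalIntegrable f volume a b) (i : Fin n) :
    IntervalIntegrable (fun t => f t i) volume a b :=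
  ⟨(ContinuousLinearMap.proj (R := ℝ) (φ := fun _ : Fin n => ℝ) i).integrable_comp hf.1,
    (ContinuousLinearMap.proj (R := ℝ) (φ := fun _ : Fin n => ℝ) i).integrable_comp hf.2⟩

theorem IntervalIntegrable.mulVec {a b : ℝ} {f : ℝ → Fin n → ℝ}
    (hf : IntervalIntegrable f volume a b) (M : Matrix (Fin m) (Fin n) ℝ) :
    IntervalIntegrable (fun t => M *ᵥ f t) volume a b :=
  ⟨M.mulVecLin.toContinuousLinearMap.integrable_comp hf.1,
    M.mulVecLin.toContinuousLinearMap.integrable_comp hf.2⟩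

theorem intervalIntegral_mulVec {a b : ℝ} {f : ℝ → Fin n → ℝ}
    (hf : IntervalIntegrable f volume a b) (M : Matrix (Fin m) (Fin n) ℝ) :
    ∫ t in a..b, M *ᵥ f t = M *ᵥ ∫ t in a..b, f t :=
  M.mulVecLin.toContinuousLinearMap.intervalIntegral_comp_comm hf

theorem integral_dotProduct_deriv_of_eq_integral {a b : ℝ} (hab : a ≤ b)
    {x y f g : ℝ → Fin n → ℝ}
    (hf : IntervalIntegrable f volume a b) (hg : IntervalIntegrable g volume a b)
    (hxc : ContinuousOn x (Set.Icc a b)) (hyc : ContinuousOn y (Set.Icc a b))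
    (hx : ∀ t ∈ Set.Icc a b, x t = x a + ∫ s in a..t, f s)
    (hy : ∀ t ∈ Set.Icc a b, y t = y a + ∫ s in a..t, g s) :
    ∫ t in a..b, (f t ⬝ᵥ y t + x t ⬝ᵥ g t) = x b ⬝ᵥ y b - x a ⬝ᵥ y a := by
  have hsub : ∀ {h : ℝ → Fin n → ℝ}, IntervalIntegrable h volume a b → ∀ t ∈ Set.Icc a b,
      IntervalIntegrable h volume a t := fun hh t ht => hh.mono_set (by
    rw [Set.uIcc_of_le hab, Set.uIcc_of_le ht.1]; exact Set.Icc_subset_Icc_right ht.2)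
  have hc : ∀ {h : ℝ → Fin n → ℝ}, ContinuousOn h (Set.Icc a b) → ∀ i,
      ContinuousOn (fun t => h t i) (Set.uIcc a b) := fun hh i => by
    rw [Set.uIcc_of_le hab]; exact (continuous_apply i).comp_continuousOn hh
  simp only [dotProduct, ← Finset.sum_add_distrib]
  rw [intervalIntegral.integral_finsetSum, ← Finset.sum_sub_distrib]
  · refine Finset.sum_congr rfl fun i _ => ?_
    refine integral_mul_deriv_of_eq_integral hab (IntervalIntegrable.apply hf i)
      (IntervalIntegrable.apply hg i) (x := fun t => x t i) (y := fun t => y t i) ?_ ?_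
    · intro t ht
      rw [← intervalIntegral_apply (hsub hf t ht)]
      exact congrFun (hx t ht) i
    · intro t ht
      rw [← intervalIntegral_apply (hsub hg t ht)]
      exact congrFun (hy t ht) i
  · intro i _
    exact ((IntervalIntegrable.apply hf i).mul_continuousOn (hc hyc i)).add
      ((IntervalIntegrable.apply hg i).continuousOn_mul (hc hxc i))

theorem intervalIntegrable_bilinear {k : ℕ} {a b : ℝ} (hab : a ≤ b) {v : ℝ → Fin m → ℝ}
    {w : ℝ → Fin k → ℝ} (hv : MemLp v 2 (volume.restrict (Set.Icc a b)))
    (hw : MemLp w 2 (volume.restrict (Set.Icc a b))) (M : Matrix (Fin m) (Fin k) ℝ) :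
    IntervalIntegrable (fun t => v t ⬝ᵥ M *ᵥ w t) volume a b := by
  rw [intervalIntegrable_iff_integrableOn_Icc_of_le hab, IntegrableOn]
  simp only [dotProduct, Matrix.mulVec]
  refine integrable_finsetSum _ fun i _ => ?_
  refine MemLp.integrable_mul (q := 2) ((memLp_pi_iff.mp hv) i) ?_
  refine memLp_finsetSum _ fun j _ => ?_
  exact ((memLp_pi_iff.mp hw) j).const_mul _

theorem MemLp.mulVec {k : ℕ} {μ : Measure ℝ} {p : ENNReal} {v : ℝ → Fin m → ℝ}
    (hv : MemLp v p μ) (M : Matrix (Fin k) (Fin m) ℝ) : MemLp (fun t => M *ᵥ v t) p μ :=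
  M.mulVecLin.toContinuousLinearMap.comp_memLp' hv

theorem memLp_of_continuousOn {a b : ℝ} {x : ℝ → Fin n → ℝ} (hx : ContinuousOn x (Set.Icc a b)) :
    MemLp x 2 (volume.restrict (Set.Icc a b)) := by
  obtain ⟨C, hC⟩ := isCompact_Icc.exists_bound_of_continuousOn hx
  exact MemLp.of_bound (hx.aestronglyMeasurable measurableSet_Icc) C
    ((ae_restrict_iff' measurableSet_Icc).mpr (Filter.Eventually.of_forall hC))

end Calculus

/-! ### Linear flows and their independence. -/

section Flow

variable {n : ℕ}

/-- The fundamental solution of `ẋ = F x`. -/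
noncomputable def flow (F : Matrix (Fin n) (Fin n) ℝ) (t : ℝ) :
    (Fin n → ℝ) →L[ℝ] (Fin n → ℝ) :=
  NormedSpace.exp (t • F.mulVecLin.toContinuousLinearMap)

theorem flow_zero (F : Matrix (Fin n) (Fin n) ℝ) (a : Fin n → ℝ) : flow F 0 a = a := by
  simp [flow, NormedSpace.exp_zero]

theorem hasDerivAt_flow (F : Matrix (Fin n) (Fin n) ℝ) (a : Fin n → ℝ) (t : ℝ) :
    HasDerivAt (fun s => flow F s a) (F *ᵥ flow F t a) t := by
  have h := hasDerivAt_exp_smul_const' (𝕂 := ℝ) F.mulVecLin.toContinuousLinearMap t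
  exact h.clm_apply (hasDerivAt_const t a) |>.congr_deriv (by simp [flow])

theorem HasDerivAt.mulVec {m : ℕ} {x : ℝ → Fin n → ℝ} {x' : Fin n → ℝ} {t : ℝ}
    (h : HasDerivAt x x' t) (M : Matrix (Fin m) (Fin n) ℝ) :
    HasDerivAt (fun s => M *ᵥ x s) (M *ᵥ x') t :=
  (M.mulVecLin.toContinuousLinearMap.hasFDerivAt (x := x t)).comp_hasDerivAt t h

/-- Flows of matrices annihilated by coprime polynomials are independent. -/
theorem eq_zero_of_flow_eq_flow_add_flow {F₁ F₂ G : Matrix (Fin n) (Fin n) ℝ} {p q : ℝ[X]}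
    (hpq : IsCoprime p q) (h1 : aeval F₁ p = 0) (h2 : aeval F₂ p = 0) (hG : aeval G q = 0)
    {a₁ a₂ b : Fin n → ℝ}
    (h : ∀ t ∈ Set.Icc (0 : ℝ) 1, flow F₁ t a₁ = flow F₂ t a₂ + flow G t b) :
    b = 0 ∧ a₁ = a₂ ∧ F₁ *ᵥ a₁ = F₂ *ᵥ a₁ := by
  -- Repeated differentiation, then `t = 0`, gives `f(F₁) a₁ = f(F₂) a₂ + f(G) b` for every
  -- polynomial `f`. Taking `f = p` yields `p(G) b = 0`, while `q(G) = 0`.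
  have hk : ∀ k : ℕ, ∀ t ∈ Set.Icc (0 : ℝ) 1,
      F₁ ^ k *ᵥ flow F₁ t a₁ = F₂ ^ k *ᵥ flow F₂ t a₂ + G ^ k *ᵥ flow G t b := by
    intro k
    induction k with
    | zero => simpa using h
    | succ k ih =>
      intro t ht
      have hd := uniqueDiffOn_Icc (zero_lt_one' ℝ) t ht
      have e1 := (HasDerivAt.mulVec (hasDerivAt_flow F₁ a₁ t) (F₁ ^ k)).hasDerivWithinAt
        (s := Set.Icc 0 1)
      have e2 := ((HasDerivAt.mulVec (hasDerivAt_flow F₂ a₂ t) (F₂ ^ k)).add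
        (HasDerivAt.mulVec (hasDerivAt_flow G b t) (G ^ k))).hasDerivWithinAt
        (s := Set.Icc 0 1)
      have e3 := hd.eq_deriv _ e1 (e2.congr (fun s hs => ih s hs) (ih t ht))
      simpa only [pow_succ, ← Matrix.mulVec_mulVec] using e3
  have h0 : ∀ k : ℕ, F₁ ^ k *ᵥ a₁ = F₂ ^ k *ᵥ a₂ + G ^ k *ᵥ b := by
    intro k
    have := hk k 0 ⟨le_rfl, zero_le_one⟩
    simpa only [flow_zero] using this
  have hpoly : ∀ f : ℝ[X], aeval F₁ f *ᵥ a₁ = aeval F₂ f *ᵥ a₂ + aeval G f *ᵥ b := by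
    intro f
    induction f using Polynomial.induction_on' with
    | add f g hf hg => simp only [map_add, Matrix.add_mulVec, hf, hg]; abel
    | monomial k a =>
      simp only [aeval_monomial, Algebra.algebraMap_eq_smul_one, Matrix.smul_mul, one_mul,
        Matrix.smul_mulVec, h0 k, smul_add]
  have hb : b = 0 := by
    refine eq_zero_of_aeval_mulVec (F := G) hpq ?_ (by rw [hG, Matrix.zero_mulVec])
    have := hpoly p
    rw [h1, h2] at this
    simpa using this.symm
  have ha : a₁ = a₂ := by simpa [hb] using h0 0
  exact ⟨hb, ha, by simpa [hb, ← ha] using h0 1⟩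

end Flow

/-! ### Operations on trajectories. -/

section Trajectory

variable {n m : ℕ} {A : Matrix (Fin n) (Fin n) ℝ} {B : Matrix (Fin n) (Fin m) ℝ} {t₀ t₁ : ℝ}
  {x y : ℝ → Fin n → ℝ} {u v : ℝ → Fin m → ℝ}

theorem IsTrajectory.memLp_state (h : IsTrajectory A B t₀ t₁ x u) :
    MemLp x 2 (volume.restrict (Set.Icc t₀ t₁)) :=
  memLp_of_continuousOn h.continuousOn

theorem IsTrajectory.intervalIntegrable (h : IsTrajectory A B t₀ t₁ x u) {t : ℝ}
    (ht : t ∈ Set.Icc t₀ t₁) :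
    IntervalIntegrable (fun s => A *ᵥ x s + B *ᵥ u s) volume t₀ t := by
  have h1 : IntegrableOn (fun s => A *ᵥ x s + B *ᵥ u s) (Set.Icc t₀ t₁) :=
    ((MemLp.mulVec h.memLp_state A).add (MemLp.mulVec h.memLp B)).integrable one_le_two
  exact (intervalIntegrable_iff_integrableOn_Icc_of_le ht.1).mpr
    (h1.mono_set (Set.Icc_subset_Icc_right ht.2))

theorem IsTrajectory.map {A' : Matrix (Fin n) (Fin n) ℝ} (h : IsTrajectory A B t₀ t₁ x u)
    {P : Matrix (Fin n) (Fin n) ℝ} {E : Matrix (Fin m) (Fin m) ℝ} (hA : P * A = A' * P)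
    (hB : P * B = B * E) :
    IsTrajectory A' B t₀ t₁ (fun t => P *ᵥ x t) (fun t => E *ᵥ u t) where
  memLp := MemLp.mulVec h.memLp E
  continuousOn := P.mulVecLin.toContinuousLinearMap.continuous.comp_continuousOn h.continuousOn
  eq_integral t ht := by
    have h1 : ∀ s, A' *ᵥ (P *ᵥ x s) + B *ᵥ (E *ᵥ u s) = P *ᵥ (A *ᵥ x s + B *ᵥ u s) := by
      intro s
      rw [Matrix.mulVec_add, Matrix.mulVec_mulVec, Matrix.mulVec_mulVec, Matrix.mulVec_mulVec,
        Matrix.mulVec_mulVec, hA, hB]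
    simp only [h1]
    rw [intervalIntegral_mulVec (h.intervalIntegrable ht), ← Matrix.mulVec_add,
      ← h.eq_integral t ht]

theorem IsTrajectory.add (h : IsTrajectory A B t₀ t₁ x u) (h' : IsTrajectory A B t₀ t₁ y v) :
    IsTrajectory A B t₀ t₁ (fun t => x t + y t) (fun t => u t + v t) where
  memLp := h.memLp.add h'.memLp
  continuousOn := h.continuousOn.add h'.continuousOn
  eq_integral t ht := by
    have h1 : ∀ s, A *ᵥ (x s + y s) + B *ᵥ (u s + v s) =
        (A *ᵥ x s + B *ᵥ u s) + (A *ᵥ y s + B *ᵥ v s) := by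
      intro s
      rw [Matrix.mulVec_add, Matrix.mulVec_add]; abel
    simp only [h1]
    rw [intervalIntegral.integral_add (h.intervalIntegrable ht) (h'.intervalIntegrable ht),
      h.eq_integral t ht, h'.eq_integral t ht]
    abel

theorem IsTrajectory.sub (h : IsTrajectory A B t₀ t₁ x u) (h' : IsTrajectory A B t₀ t₁ y v) :
    IsTrajectory A B t₀ t₁ (fun t => x t - y t) (fun t => u t - v t) := by
  have h1 := h.add (h'.map (A' := A) (P := -1) (E := -1) (by simp) (by simp))
  simpa [Matrix.neg_mulVec, sub_eq_add_neg] using h1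

theorem IsTrajectory.feedback (h : IsTrajectory A B t₀ t₁ x u) (K : Matrix (Fin m) (Fin n) ℝ) :
    IsTrajectory (A - B * K) B t₀ t₁ x (fun t => u t + K *ᵥ x t) where
  memLp := h.memLp.add (MemLp.mulVec h.memLp_state K)
  continuousOn := h.continuousOn
  eq_integral t ht := by
    have h1 : ∀ s, (A - B * K) *ᵥ x s + B *ᵥ (u s + K *ᵥ x s) = A *ᵥ x s + B *ᵥ u s := by
      intro s
      rw [Matrix.sub_mulVec, Matrix.mulVec_add, Matrix.mulVec_mulVec]; abel
    simp only [h1]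
    exact h.eq_integral t ht

theorem IsTrajectory.of_feedback {K : Matrix (Fin m) (Fin n) ℝ}
    (h : IsTrajectory (A - B * K) B t₀ t₁ x v) :
    IsTrajectory A B t₀ t₁ x (fun t => v t - K *ᵥ x t) := by
  simpa [Matrix.mul_neg, Matrix.neg_mulVec, sub_eq_add_neg] using h.feedback (-K)

theorem isTrajectory_of_hasDerivAt (hx : ∀ t, HasDerivAt x (A *ᵥ x t + B *ᵥ u t) t)
    (hu : Continuous u) : IsTrajectory A B t₀ t₁ x u where
  memLp := memLp_of_continuousOn hu.continuousOn
  continuousOn := (continuous_iff_continuousAt.mpr fun t => (hx t).continuousAt).continuousOn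
  eq_integral t _ := by
    have hc : Continuous x := continuous_iff_continuousAt.mpr fun t => (hx t).continuousAt
    rw [intervalIntegral.integral_eq_sub_of_hasDerivAt (fun s _ => hx s)]
    · abel
    · apply Continuous.intervalIntegrable
      exact (A.mulVecLin.toContinuousLinearMap.continuous.comp hc).add
        (B.mulVecLin.toContinuousLinearMap.continuous.comp hu)

/-- Integration by parts along a solution of the adjoint equation. -/
theorem IsTrajectory.adjoint_identity (h : IsTrajectory A B t₀ t₁ y v) {p : ℝ → Fin n → ℝ}
    (hp : ∀ t, HasDerivAt p (-(Aᵀ *ᵥ p t)) t) {t : ℝ} (ht : t ∈ Set.Icc t₀ t₁) :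
    ∫ s in t₀..t, (p s ⬝ᵥ B *ᵥ v s) = p t ⬝ᵥ y t - p t₀ ⬝ᵥ y t₀ := by
  have hpc : Continuous p := continuous_iff_continuousAt.mpr fun t => (hp t).continuousAt
  have hpc' : Continuous fun s => -(Aᵀ *ᵥ p s) :=
    (Aᵀ.mulVecLin.toContinuousLinearMap.continuous.comp hpc).neg
  rw [← integral_dotProduct_deriv_of_eq_integral ht.1 (hpc'.intervalIntegrable _ _)
    (h.intervalIntegrable ht) hpc.continuousOn
    (h.continuousOn.mono (Set.Icc_subset_Icc_right ht.2))]
  · congr 1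
    ext s
    rw [dotProduct_add, neg_dotProduct, Matrix.mulVec_transpose, ← Matrix.dotProduct_mulVec]
    ring
  · intro s _
    rw [intervalIntegral.integral_eq_sub_of_hasDerivAt (fun s _ => hp s)
      (hpc'.intervalIntegrable _ _)]
    abel
  · intro s hs
    exact h.eq_integral s ⟨hs.1, hs.2.trans ht.2⟩

/-- The integrand is the derivative of `xᵀ P x`; adding it to a cost leaves the minimizers
unchanged. -/
theorem IsTrajectory.integral_storage (h : IsTrajectory A B t₀ t₁ x u) (hle : t₀ ≤ t₁)
    {P : Matrix (Fin n) (Fin n) ℝ} (hP : Pᵀ = P) :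
    ∫ t in t₀..t₁, (2 * (x t ⬝ᵥ P *ᵥ (A *ᵥ x t + B *ᵥ u t))) =
      x t₁ ⬝ᵥ P *ᵥ x t₁ - x t₀ ⬝ᵥ P *ᵥ x t₀ := by
  have ht := Set.right_mem_Icc.mpr hle
  have hi := h.intervalIntegrable ht
  have key := integral_dotProduct_deriv_of_eq_integral (y := fun t => P *ᵥ x t) hle hi
    (IntervalIntegrable.mulVec hi P) h.continuousOn
    (P.mulVecLin.toContinuousLinearMap.continuous.comp_continuousOn h.continuousOn)
    h.eq_integral ?_
  · rw [← key]
    congr 1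
    ext s
    have : ∀ a b : Fin n → ℝ, a ⬝ᵥ P *ᵥ b = b ⬝ᵥ P *ᵥ a := by
      intro a b
      rw [Matrix.dotProduct_mulVec, ← Matrix.mulVec_transpose, hP, dotProduct_comm]
    rw [this (A *ᵥ x s + B *ᵥ u s) (x s)]
    ring
  · intro t ht
    have hi := h.intervalIntegrable ht
    rw [intervalIntegral_mulVec hi, ← Matrix.mulVec_add, ← h.eq_integral t ht]

/-- A trajectory starting at the origin with zero control vanishes. -/
theorem IsTrajectory.eq_zero (h : IsTrajectory A B t₀ t₁ y v) (h0 : y t₀ = 0)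
    (hv : v =ᵐ[volume.restrict (Set.Icc t₀ t₁)] 0) {t : ℝ} (ht : t ∈ Set.Icc t₀ t₁) :
    y t = 0 := by
  apply dotProduct_eq
  intro q
  rw [zero_dotProduct, dotProduct_comm]
  -- The adjoint solution equal to `q` at time `t` tests `y t` against an arbitrary vector `q`.
  have hp : ∀ s, HasDerivAt (fun s => flow (-Aᵀ) (s - t) q)
      (-(Aᵀ *ᵥ flow (-Aᵀ) (s - t) q)) s := by
    intro s
    have := (hasDerivAt_flow (-Aᵀ) q (s - t)).comp_sub_const s t
    rwa [Matrix.neg_mulVec] at this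
  have h1 := h.adjoint_identity hp ht
  rw [sub_self, flow_zero, h0, dotProduct_zero, sub_zero] at h1
  rw [← h1]
  apply intervalIntegral.integral_zero_ae
  have h2 := (ae_restrict_iff' measurableSet_Icc).mp hv
  filter_upwards [h2] with s hs hs'
  rw [Set.uIoc_of_le ht.1] at hs'
  rw [hs ⟨hs'.1.le, hs'.2.trans ht.2⟩]
  simp

end Trajectory

/-! ### Costs with the same synthesis. -/

section Costs

variable {n m : ℕ} {A : Matrix (Fin n) (Fin n) ℝ} {B : Matrix (Fin n) (Fin m) ℝ}

/-- The cost `wᵀ R w`. -/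
def controlCost (n : ℕ) {m : ℕ} (R : Matrix (Fin m) (Fin m) ℝ) (_ : Fin n → ℝ) (w : Fin m → ℝ) :
    ℝ := w ⬝ᵥ R *ᵥ w

theorem synthesis_feedbackCost (A : Matrix (Fin n) (Fin n) ℝ) (B : Matrix (Fin n) (Fin m) ℝ)
    (R : Matrix (Fin m) (Fin m) ℝ) (K : Matrix (Fin m) (Fin n) ℝ) :
    synthesis A B (feedbackCost R K) = synthesis (A - B * K) B (controlCost n R) := by
  ext ⟨t₀, t₁, x⟩
  simp only [synthesis, Set.mem_ofPred_eq]
  refine and_congr_right fun _ => ⟨?_, ?_⟩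
  · rintro ⟨u, hu, hmin⟩
    refine ⟨_, hu.feedback K, fun y v hv h0 h1 => ?_⟩
    have := hmin y _ hv.of_feedback h0 h1
    simpa [feedbackCost, controlCost] using this
  · rintro ⟨w, hw, hmin⟩
    refine ⟨_, hw.of_feedback, fun y v hv h0 h1 => ?_⟩
    have := hmin y _ (hv.feedback K) h0 h1
    simpa [feedbackCost, controlCost] using this

theorem synthesis_congr {c₁ c₂ : (Fin n → ℝ) → (Fin m → ℝ) → ℝ} {α : ℝ} (hα : 0 < α)
    (g : (Fin n → ℝ) → (Fin n → ℝ) → ℝ)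
    (h : ∀ t₀ t₁ x u, t₀ < t₁ → IsTrajectory A B t₀ t₁ x u →
      ∫ t in t₀..t₁, c₁ (x t) (u t) = α * (∫ t in t₀..t₁, c₂ (x t) (u t)) + g (x t₀) (x t₁)) :
    synthesis A B c₁ = synthesis A B c₂ := by
  ext ⟨t₀, t₁, x⟩
  simp only [synthesis, Set.mem_ofPred_eq]
  refine and_congr_right fun ht => exists_congr fun u => and_congr_right fun hu =>
    forall_congr' fun y => forall_congr' fun v => forall_congr' fun hv => forall_congr' fun h0 =>
    forall_congr' fun h1 => ?_
  rw [h t₀ t₁ x u ht hu, h t₀ t₁ y v ht hv, h0, h1, add_le_add_iff_right,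
    mul_le_mul_iff_right₀ hα]

theorem synthesis_feedbackCost_smul (R : Matrix (Fin m) (Fin m) ℝ) (K : Matrix (Fin m) (Fin n) ℝ)
    {α : ℝ} (hα : 0 < α) :
    synthesis A B (feedbackCost (α • R) K) = synthesis A B (feedbackCost R K) := by
  refine synthesis_congr hα (fun _ _ => 0) fun t₀ t₁ x u _ _ => ?_
  simp [feedbackCost, Matrix.smul_mulVec, dotProduct_smul]

/-- Completion of the square: `hK` matches the cross terms, and `hQ`, the Riccati equation, the
terms in `x` alone. -/
theorem quadCost_eq_feedbackCost_add {Q : Matrix (Fin n) (Fin n) ℝ}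
    {S : Matrix (Fin n) (Fin m) ℝ} {R : Matrix (Fin m) (Fin m) ℝ} {K : Matrix (Fin m) (Fin n) ℝ}
    {P : Matrix (Fin n) (Fin n) ℝ} (hP : Pᵀ = P) (hR : Rᵀ = R) (hK : R * K = Sᵀ - Bᵀ * P)
    (hQ : Kᵀ * R * K = Q - P * A - Aᵀ * P) (x : Fin n → ℝ) (u : Fin m → ℝ) :
    quadCost Q S R x u = feedbackCost R K x u + 2 * (x ⬝ᵥ P *ᵥ (A *ᵥ x + B *ᵥ u)) := by
  have sw : ∀ {k l : ℕ} (M : Matrix (Fin k) (Fin l) ℝ) (a : Fin k → ℝ) (b : Fin l → ℝ),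
      a ⬝ᵥ M *ᵥ b = b ⬝ᵥ Mᵀ *ᵥ a := by
    intro k l M a b
    rw [Matrix.dotProduct_mulVec, ← Matrix.mulVec_transpose, dotProduct_comm]
  have e1 : (K *ᵥ x) ⬝ᵥ R *ᵥ u = u ⬝ᵥ (R * K) *ᵥ x := by
    rw [sw, hR, Matrix.mulVec_mulVec]
  have e2 : u ⬝ᵥ R *ᵥ K *ᵥ x = u ⬝ᵥ (R * K) *ᵥ x := by rw [Matrix.mulVec_mulVec]
  have e3 : (K *ᵥ x) ⬝ᵥ R *ᵥ K *ᵥ x = x ⬝ᵥ (Kᵀ * R * K) *ᵥ x := by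
    rw [← Matrix.mulVec_mulVec, ← Matrix.mulVec_mulVec, sw Kᵀ, Matrix.transpose_transpose,
      dotProduct_comm]
  have e4 : u ⬝ᵥ (Bᵀ * P) *ᵥ x = x ⬝ᵥ P *ᵥ B *ᵥ u := by
    rw [sw, Matrix.transpose_mul, hP, Matrix.transpose_transpose, ← Matrix.mulVec_mulVec]
  have e5 : x ⬝ᵥ (Aᵀ * P) *ᵥ x = x ⬝ᵥ P *ᵥ A *ᵥ x := by
    rw [sw, Matrix.transpose_mul, hP, Matrix.transpose_transpose, ← Matrix.mulVec_mulVec]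
  have e7 : x ⬝ᵥ (P * A) *ᵥ x = x ⬝ᵥ P *ᵥ A *ᵥ x := by rw [Matrix.mulVec_mulVec]
  have e6 : u ⬝ᵥ Sᵀ *ᵥ x = x ⬝ᵥ S *ᵥ u := (sw S x u).symm
  simp only [quadCost, feedbackCost, add_dotProduct, Matrix.mulVec_add, dotProduct_add, e1, e2,
    e3, hK, hQ, Matrix.sub_mulVec, dotProduct_sub, e4, e5, e6, e7]
  ring

theorem synthesis_quadCost_eq {Q : Matrix (Fin n) (Fin n) ℝ}
    {S : Matrix (Fin n) (Fin m) ℝ} {R : Matrix (Fin m) (Fin m) ℝ} {K : Matrix (Fin m) (Fin n) ℝ}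
    {P : Matrix (Fin n) (Fin n) ℝ} (hP : Pᵀ = P) (hR : Rᵀ = R) (hK : R * K = Sᵀ - Bᵀ * P)
    (hQ : Kᵀ * R * K = Q - P * A - Aᵀ * P) :
    synthesis A B (quadCost Q S R) = synthesis A B (feedbackCost R K) := by
  refine synthesis_congr one_pos (fun a b => b ⬝ᵥ P *ᵥ b - a ⬝ᵥ P *ᵥ a)
    fun t₀ t₁ x u ht hx => ?_
  simp only [quadCost_eq_feedbackCost_add hP hR hK hQ]
  rw [one_mul, intervalIntegral.integral_add, hx.integral_storage ht.le hP]
  · have := hx.feedback K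
    exact intervalIntegrable_bilinear ht.le this.memLp this.memLp R
  · have h1 := (MemLp.mulVec hx.memLp_state A).add (MemLp.mulVec hx.memLp B)
    exact (intervalIntegrable_bilinear ht.le hx.memLp_state h1 P).const_mul 2

/-- Allows `synthesis_quadCost_eq` to start from a canonical cost and pass to another Riccati
solution. -/
theorem feedbackCost_eq_quadCost (R : Matrix (Fin m) (Fin m) ℝ) (K : Matrix (Fin m) (Fin n) ℝ)
    (hR : Rᵀ = R) : feedbackCost R K = quadCost (Kᵀ * R * K) (Kᵀ * R) R := by
  ext x u
  have := quadCost_eq_feedbackCost_add (A := 0) (B := (0 : Matrix (Fin n) (Fin m) ℝ))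
    (P := 0) (Q := Kᵀ * R * K) (S := Kᵀ * R) (R := R) (K := K) (by simp) hR
    (by simp [Matrix.transpose_mul, hR]) (by simp) x u
  simpa using this.symm

end Costs

/-! ### Minimizers as sums of a stable and an antistable flow. -/

section Minimizers

variable {n m : ℕ} {F G P : Matrix (Fin n) (Fin n) ℝ} {B : Matrix (Fin n) (Fin m) ℝ}
  {R : Matrix (Fin m) (Fin m) ℝ}

theorem transpose_eq_of_posDef (hR : R.PosDef) : Rᵀ = R := by
  have := hR.isHermitian
  simpa [Matrix.IsHermitian, Matrix.conjTranspose_eq_transpose_of_trivial] using this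

theorem isUnit_det_of_posDef (hR : R.PosDef) : IsUnit R.det :=
  (Matrix.isUnit_iff_isUnit_det R).mp hR.isUnit

theorem controlCost_nonneg (hR : R.PosDef) (x : Fin n → ℝ) (w : Fin m → ℝ) :
    0 ≤ controlCost n R x w := by
  have := hR.posSemidef.dotProduct_mulVec_nonneg w
  simpa [controlCost] using this

/-- A trajectory starting at the origin with nonpositive cost vanishes. -/
theorem IsTrajectory.eq_zero_of_cost_nonpos (hR : R.PosDef) {t₀ t₁ : ℝ} (hle : t₀ ≤ t₁)
    {y : ℝ → Fin n → ℝ} {v : ℝ → Fin m → ℝ} (h : IsTrajectory F B t₀ t₁ y v) (h0 : y t₀ = 0)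
    (hc : ∫ t in t₀..t₁, controlCost n R (y t) (v t) ≤ 0) {t : ℝ} (ht : t ∈ Set.Icc t₀ t₁) :
    y t = 0 := by
  refine h.eq_zero h0 ?_ ht
  have hi := intervalIntegrable_bilinear hle h.memLp h.memLp R
  have h1 : ∫ t in t₀..t₁, controlCost n R (y t) (v t) = 0 :=
    le_antisymm hc (intervalIntegral.integral_nonneg_of_forall hle
      fun t => controlCost_nonneg hR _ _)
  rw [intervalIntegral.integral_of_le hle, ← integral_Icc_eq_integral_Ioc] at h1
  rw [intervalIntegrable_iff_integrableOn_Icc_of_le hle] at hi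
  have h2 := (integral_eq_zero_iff_of_nonneg
    (fun t => controlCost_nonneg hR (y t) (v t)) hi).mp h1
  filter_upwards [h2] with s hs
  by_contra hne
  have h3 := hR.dotProduct_mulVec_pos hne
  rw [star_trivial] at h3
  exact h3.ne' hs

/-- The zero control costs nothing. No stability is required, so this serves for both `F` and `G`.
-/
theorem flow_mem_synthesis (hR : R.PosDef) (a : Fin n → ℝ) :
    ((0 : ℝ), (1 : ℝ), fun t => flow F t a) ∈ synthesis F B (controlCost n R) := by
  refine ⟨zero_lt_one, fun _ => 0, isTrajectory_of_hasDerivAt (fun t => ?_) continuous_const,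
    fun y v _ _ _ => ?_⟩
  · simpa using hasDerivAt_flow F a t
  · have h0 : ∫ t in (0 : ℝ)..1, controlCost n R (flow F t a) 0 = 0 := by simp [controlCost]
    change ∫ t in (0 : ℝ)..1, controlCost n R (flow F t a) 0 ≤ _
    rw [h0]
    exact intervalIntegral.integral_nonneg_of_forall zero_le_one
      fun t => controlCost_nonneg hR _ _

theorem continuous_flow (F : Matrix (Fin n) (Fin n) ℝ) (a : Fin n → ℝ) :
    Continuous fun t => flow F t a :=
  continuous_iff_continuousAt.mpr fun t => (hasDerivAt_flow F a t).continuousAt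

/-- `e^{tF} a` needs no control, and `hN` says that the displayed control turns the drift `F` into
`G` along `e^{tG} b`. -/
theorem isTrajectory_flow_add_flow (hN : B * R⁻¹ * Bᵀ * P = G - F) (a b : Fin n → ℝ)
    (t₀ t₁ : ℝ) :
    IsTrajectory F B t₀ t₁ (fun t => flow F t a + flow G t b)
      (fun t => (R⁻¹ * Bᵀ * P) *ᵥ flow G t b) := by
  apply isTrajectory_of_hasDerivAt
  · intro t
    refine ((hasDerivAt_flow F a t).add (hasDerivAt_flow G b t)).congr_deriv ?_
    rw [Matrix.mulVec_mulVec, ← Matrix.mul_assoc, ← Matrix.mul_assoc, hN, Matrix.mulVec_add,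
      Matrix.sub_mulVec]
    abel
  · exact (R⁻¹ * Bᵀ * P).mulVecLin.toContinuousLinearMap.continuous.comp (continuous_flow G b)

/-- The control of `e^{tF} a + e^{tG} b` is orthogonal to all controls steering `0` to `0`. -/
theorem integral_flow_control_eq_zero (hR : R.PosDef) (hPG : P * G = -(Fᵀ * P))
    (b : Fin n → ℝ) {t₀ t₁ : ℝ} (hle : t₀ ≤ t₁) {y : ℝ → Fin n → ℝ} {v : ℝ → Fin m → ℝ}
    (h : IsTrajectory F B t₀ t₁ y v) (h0 : y t₀ = 0) (h1 : y t₁ = 0) :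
    ∫ t in t₀..t₁, ((R⁻¹ * Bᵀ * P) *ᵥ flow G t b) ⬝ᵥ R *ᵥ v t = 0 := by
  -- By `hPG`, `P e^{tG} b` solves the adjoint equation, so its pairing with `B v` integrates to
  -- endpoint terms, which vanish here.
  have hp : ∀ t, HasDerivAt (fun t => P *ᵥ flow G t b) (-(Fᵀ *ᵥ (P *ᵥ flow G t b))) t := by
    intro t
    refine (HasDerivAt.mulVec (hasDerivAt_flow G b t) P).congr_deriv ?_
    rw [Matrix.mulVec_mulVec, hPG, Matrix.neg_mulVec, ← Matrix.mulVec_mulVec]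
  have h2 := h.adjoint_identity hp (Set.right_mem_Icc.mpr hle)
  rw [h0, h1, dotProduct_zero, dotProduct_zero, sub_zero] at h2
  rw [← h2]
  congr 1
  ext t
  rw [Matrix.dotProduct_mulVec _ R, ← Matrix.mulVec_transpose, transpose_eq_of_posDef hR,
    Matrix.mulVec_mulVec, ← Matrix.mul_assoc, ← Matrix.mul_assoc,
    Matrix.mul_nonsing_inv _ (isUnit_det_of_posDef hR), Matrix.one_mul, ← Matrix.mulVec_mulVec,
    Matrix.mulVec_transpose, ← Matrix.dotProduct_mulVec]

theorem controlCost_add (hR : R.PosDef) (x y z : Fin n → ℝ) (v w : Fin m → ℝ) :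
    controlCost n R x (v + w) = controlCost n R y v + 2 * (v ⬝ᵥ R *ᵥ w) + controlCost n R z w := by
  have : w ⬝ᵥ R *ᵥ v = v ⬝ᵥ R *ᵥ w := by
    rw [Matrix.dotProduct_mulVec, ← Matrix.mulVec_transpose, transpose_eq_of_posDef hR,
      dotProduct_comm]
  simp only [controlCost, add_dotProduct, Matrix.mulVec_add, dotProduct_add, this]
  ring

/-- Pythagoras: the difference of two trajectories with the same endpoints has a control orthogonal
to the extremal one. -/
theorem integral_controlCost_flow_add (hR : R.PosDef) (hPG : P * G = -(Fᵀ * P))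
    (hN : B * R⁻¹ * Bᵀ * P = G - F) (a b : Fin n → ℝ) {t₀ t₁ : ℝ} (hle : t₀ ≤ t₁)
    {x : ℝ → Fin n → ℝ} {w : ℝ → Fin m → ℝ} (h : IsTrajectory F B t₀ t₁ x w)
    (h0 : x t₀ = flow F t₀ a + flow G t₀ b) (h1 : x t₁ = flow F t₁ a + flow G t₁ b) :
    ∫ t in t₀..t₁, controlCost n R (x t) (w t) =
      (∫ t in t₀..t₁, controlCost n R (flow F t a + flow G t b) ((R⁻¹ * Bᵀ * P) *ᵥ flow G t b)) +
      ∫ t in t₀..t₁, controlCost n R (x t - (flow F t a + flow G t b))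
        (w t - (R⁻¹ * Bᵀ * P) *ᵥ flow G t b) := by
  have hz := isTrajectory_flow_add_flow (F := F) (P := P) hN a b t₀ t₁
  have hd := h.sub hz
  have hor := integral_flow_control_eq_zero hR hPG b hle hd (by simp [h0]) (by simp [h1])
  have i1 := intervalIntegrable_bilinear hle hz.memLp hz.memLp R
  have i2 := intervalIntegrable_bilinear hle hz.memLp hd.memLp R
  have i3 := intervalIntegrable_bilinear hle hd.memLp hd.memLp R
  have e : ∀ t, controlCost n R (x t) (w t) =
      controlCost n R (flow F t a + flow G t b) ((R⁻¹ * Bᵀ * P) *ᵥ flow G t b) +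
      2 * (((R⁻¹ * Bᵀ * P) *ᵥ flow G t b) ⬝ᵥ R *ᵥ (w t - (R⁻¹ * Bᵀ * P) *ᵥ flow G t b)) +
      controlCost n R (x t - (flow F t a + flow G t b))
        (w t - (R⁻¹ * Bᵀ * P) *ᵥ flow G t b) := by
    intro t
    rw [← controlCost_add hR (x t)]
    congr 1
    abel
  simp only [e]
  refine (intervalIntegral.integral_add (i1.add (i2.const_mul 2)) i3).trans ?_
  congr 1
  refine (intervalIntegral.integral_add i1 (i2.const_mul 2)).trans ?_
  rw [intervalIntegral.integral_const_mul, hor, mul_zero, add_zero]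
  rfl

/-- The endpoint map is an endomorphism of `ℝⁿ × ℝⁿ`. If both endpoints vanish, the control is
orthogonal to itself, so the trajectory is zero, and independence of the flows gives `a = b = 0`. -/
theorem exists_flow_add_flow_endpoints (hR : R.PosDef) (hPG : P * G = -(Fᵀ * P))
    (hN : B * R⁻¹ * Bᵀ * P = G - F) (hF : Stable F) (hG : Antistable G) (x₀ x₁ : Fin n → ℝ) :
    ∃ a b, x₀ = flow F 0 a + flow G 0 b ∧ x₁ = flow F 1 a + flow G 1 b := by
  let T : (Fin n → ℝ) × (Fin n → ℝ) →ₗ[ℝ] (Fin n → ℝ) × (Fin n → ℝ) :=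
    LinearMap.prod
      (LinearMap.coprod (flow F 0).toLinearMap (flow G 0).toLinearMap)
      (LinearMap.coprod (flow F 1).toLinearMap (flow G 1).toLinearMap)
  have hT : Function.Injective T := by
    rw [← LinearMap.ker_eq_bot, LinearMap.ker_eq_bot']
    rintro ⟨a, b⟩ hab
    have h0 : flow F 0 a + flow G 0 b = 0 := congrArg Prod.fst hab
    have h1 : flow F 1 a + flow G 1 b = 0 := congrArg Prod.snd hab
    have hz := isTrajectory_flow_add_flow (F := F) (P := P) hN a b 0 1
    have hor := integral_flow_control_eq_zero hR hPG b zero_le_one hz h0 h1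
    obtain ⟨p, hp, hpF⟩ := hF
    obtain ⟨q, hq, hqG⟩ := hG
    have h2 := eq_zero_of_flow_eq_flow_add_flow (a₁ := 0) (a₂ := a) (b := b) (hp.isCoprime hq) hpF hpF hqG
      (fun t ht => by
        have := hz.eq_zero_of_cost_nonpos hR zero_le_one h0 hor.le ht
        rw [map_zero]; exact this.symm)
    rw [h2.1, ← h2.2.1]; rfl
  obtain ⟨⟨a, b⟩, hab⟩ := LinearMap.injective_iff_surjective.mp hT (x₀, x₁)
  exact ⟨a, b, (congrArg Prod.fst hab).symm, (congrArg Prod.snd hab).symm⟩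

theorem exists_flow_add_flow_of_mem_synthesis (hR : R.PosDef) (hPG : P * G = -(Fᵀ * P))
    (hN : B * R⁻¹ * Bᵀ * P = G - F) (hF : Stable F) (hG : Antistable G) {x : ℝ → Fin n → ℝ}
    (hx : ((0 : ℝ), (1 : ℝ), x) ∈ synthesis F B (controlCost n R)) :
    ∃ a b, ∀ t ∈ Set.Icc (0 : ℝ) 1, x t = flow F t a + flow G t b := by
  obtain ⟨-, w, hw, hmin⟩ := hx
  obtain ⟨a, b, h0, h1⟩ := exists_flow_add_flow_endpoints hR hPG hN hF hG (x 0) (x 1)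
  refine ⟨a, b, fun t ht => ?_⟩
  have hz := isTrajectory_flow_add_flow (F := F) (P := P) hN a b 0 1
  have hc := integral_controlCost_flow_add hR hPG hN a b zero_le_one hw h0 h1
  have hle := hmin _ _ hz h0.symm h1.symm
  have := (hw.sub hz).eq_zero_of_cost_nonpos hR zero_le_one (by simp [h0]) (by linarith) ht
  exact sub_eq_zero.mp this

end Minimizers

/-! ### The Gramian and the antistable closed loop. -/

section Gramian

variable {n m : ℕ} {F : Matrix (Fin n) (Fin n) ℝ} {B : Matrix (Fin n) (Fin m) ℝ}
  {R : Matrix (Fin m) (Fin m) ℝ}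

/-- Uniqueness in the Sylvester equation makes `W` symmetric. If `W p = 0`, the equation gives first
`Bᵀ p = 0`, then `W Fᵀ p = 0`, so controllability forces `p = 0`. -/
theorem exists_gramian (hR : R.PosDef) (hF : Stable F) (hFB : IsKalman F B) :
    ∃ W : Matrix (Fin n) (Fin n) ℝ, Wᵀ = W ∧ IsUnit W.det ∧
      F * W + W * Fᵀ + B * R⁻¹ * Bᵀ = 0 := by
  have hRt : R⁻¹ᵀ = R⁻¹ := transpose_eq_of_posDef hR.inv
  have hNt : (B * R⁻¹ * Bᵀ)ᵀ = B * R⁻¹ * Bᵀ := by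
    rw [Matrix.transpose_mul, Matrix.transpose_mul, Matrix.transpose_transpose, hRt,
      Matrix.mul_assoc]
  obtain ⟨W, hW, hu⟩ := existsUnique_sylvester hF hF.transpose.neg (-(B * R⁻¹ * Bᵀ))
  simp only [mul_neg, sub_neg_eq_add] at hW hu
  have hWt : Wᵀ = W := by
    apply hu
    have := congrArg Matrix.transpose hW
    rw [Matrix.transpose_neg, hNt, Matrix.transpose_add, Matrix.transpose_mul,
      Matrix.transpose_mul, Matrix.transpose_transpose] at this
    rw [← this, add_comm]
  refine ⟨W, hWt, ?_, by rw [hW, neg_add_cancel]⟩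
  rw [isUnit_iff_ne_zero]
  intro hdet
  obtain ⟨p, hp0, hp⟩ := Matrix.exists_mulVec_eq_zero_iff.mpr hdet
  apply hp0
  have hsw : ∀ a b : Fin n → ℝ, a ⬝ᵥ W *ᵥ b = b ⬝ᵥ W *ᵥ a := by
    intro a b
    rw [Matrix.dotProduct_mulVec, ← Matrix.mulVec_transpose, hWt, dotProduct_comm]
  have hB : ∀ p, W *ᵥ p = 0 → Bᵀ *ᵥ p = 0 := by
    intro p hp
    apply mulVec_eq_zero_of_posDef hR
    rw [← neg_eq_zero, ← dotProduct_neg, ← Matrix.neg_mulVec, ← hW, Matrix.add_mulVec,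
      ← Matrix.mulVec_mulVec, hp, Matrix.mulVec_zero, zero_add, ← Matrix.mulVec_mulVec, hsw, hp,
      dotProduct_zero]
  refine hFB.eq_zero (LinearMap.ker W.mulVecLin) (fun p hp => hB p hp) (fun p hp => ?_) (p := p) hp
  change W *ᵥ p = 0 at hp
  change W *ᵥ (Fᵀ *ᵥ p) = 0
  have h1 := congrArg (fun M => M *ᵥ p) hW
  simp only [Matrix.add_mulVec, ← Matrix.mulVec_mulVec, Matrix.neg_mulVec] at h1
  rw [hp, hB p hp] at h1
  simpa using h1

/-- The data attached to a canonical cost: the Gramian `W` and the antistable matrix `G`. -/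
structure IsDual (F G W : Matrix (Fin n) (Fin n) ℝ) (B : Matrix (Fin n) (Fin m) ℝ)
    (R : Matrix (Fin m) (Fin m) ℝ) : Prop where
  symm : Wᵀ = W
  isUnit : IsUnit W.det
  eq : G = F + B * R⁻¹ * Bᵀ * W⁻¹
  conj : G * W = W * -Fᵀ
  antistable : Antistable G

theorem exists_isDual (hR : R.PosDef) (hF : Stable F) (hFB : IsKalman F B) :
    ∃ G W, IsDual F G W B R := by
  obtain ⟨W, hWt, hWu, hW⟩ := exists_gramian hR hF hFB
  have hc : (F + B * R⁻¹ * Bᵀ * W⁻¹) * W = W * -Fᵀ := by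
    rw [Matrix.add_mul, Matrix.mul_assoc _ W⁻¹ W, Matrix.nonsing_inv_mul _ hWu, mul_one,
      mul_neg, eq_neg_iff_add_eq_zero, ← hW]
    abel
  exact ⟨_, W, hWt, hWu, rfl, hc,
    hF.transpose.neg.conj ((Matrix.isUnit_iff_isUnit_det W).mpr hWu) hc⟩

variable {G W : Matrix (Fin n) (Fin n) ℝ}

theorem IsDual.inv_mul (h : IsDual F G W B R) : W⁻¹ * G = -(Fᵀ * W⁻¹) := by
  have h1 : W⁻¹ * (G * W) * W⁻¹ = W⁻¹ * (W * -Fᵀ) * W⁻¹ := by rw [h.conj]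
  rwa [← Matrix.mul_assoc W⁻¹ W, Matrix.nonsing_inv_mul _ h.isUnit, one_mul, Matrix.mul_assoc,
    Matrix.mul_assoc, Matrix.mul_nonsing_inv _ h.isUnit, mul_one, neg_mul] at h1

theorem IsDual.sub_eq (h : IsDual F G W B R) : B * R⁻¹ * Bᵀ * W⁻¹ = G - F := by
  rw [h.eq]; abel

/-- `W⁻¹` is a Riccati solution for the canonical cost itself. Completing the square with it
replaces `K` by `K - R⁻¹ Bᵀ W⁻¹`, whose closed loop is `G`. -/
theorem IsDual.synthesis_eq {A : Matrix (Fin n) (Fin n) ℝ} {K : Matrix (Fin m) (Fin n) ℝ}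
    (hR : R.PosDef) (h : IsDual (A - B * K) G W B R) :
    synthesis A B (feedbackCost R K) = synthesis G B (controlCost n R) := by
  have hRt := transpose_eq_of_posDef hR
  have hRi : R⁻¹ᵀ = R⁻¹ := transpose_eq_of_posDef hR.inv
  have hRu := isUnit_det_of_posDef hR
  have hWi : W⁻¹ᵀ = W⁻¹ := by rw [Matrix.transpose_nonsing_inv, h.symm]
  have hRK : R * (K - R⁻¹ * Bᵀ * W⁻¹) = R * K - Bᵀ * W⁻¹ := by
    rw [Matrix.mul_sub, ← Matrix.mul_assoc, ← Matrix.mul_assoc, Matrix.mul_nonsing_inv _ hRu,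
      Matrix.one_mul]
  rw [feedbackCost_eq_quadCost R K hRt, synthesis_quadCost_eq (K := K - R⁻¹ * Bᵀ * W⁻¹) hWi hRt,
    synthesis_feedbackCost]
  · congr 1
    rw [h.eq, Matrix.mul_sub]
    simp only [Matrix.mul_assoc]
    abel
  · rw [hRK, Matrix.transpose_mul, Matrix.transpose_transpose, hRt]
  · have h1 := h.inv_mul
    rw [h.eq] at h1
    have h2 : W⁻¹ * (B * R⁻¹ * Bᵀ * W⁻¹) =
        -((A - B * K)ᵀ * W⁻¹) - W⁻¹ * (A - B * K) := by
      rw [← h1, Matrix.mul_add]; abel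
    have h3 : W⁻¹ * B * R⁻¹ * (R * K) = W⁻¹ * (B * K) := by
      rw [Matrix.mul_assoc _ R⁻¹, Matrix.nonsing_inv_mul_cancel_left _ _ hRu, Matrix.mul_assoc]
    rw [Matrix.mul_assoc, hRK, Matrix.transpose_sub, Matrix.transpose_mul, Matrix.transpose_mul,
      hWi, hRi, Matrix.transpose_transpose, Matrix.sub_mul, Matrix.mul_sub,
      ← Matrix.mul_assoc W⁻¹ B, Matrix.mul_sub, h3,
      show W⁻¹ * B * R⁻¹ * (Bᵀ * W⁻¹) = W⁻¹ * (B * R⁻¹ * Bᵀ * W⁻¹) by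
        simp only [Matrix.mul_assoc], h2]
    simp only [Matrix.transpose_sub, Matrix.transpose_mul, Matrix.sub_mul, Matrix.mul_sub,
      Matrix.mul_assoc]
    abel

/-- Two canonical costs with the same synthesis have the same closed loop matrices `F` and `G`. -/
theorem closedLoop_eq_of_synthesis_eq {A G' W' : Matrix (Fin n) (Fin n) ℝ}
    {K K' : Matrix (Fin m) (Fin n) ℝ} {R' : Matrix (Fin m) (Fin m) ℝ}
    (hR : R.PosDef) (hR' : R'.PosDef) (hF : Stable (A - B * K)) (hF' : Stable (A - B * K'))
    (h : IsDual (A - B * K) G W B R) (h' : IsDual (A - B * K') G' W' B R')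
    (hs : synthesis A B (feedbackCost R K) = synthesis A B (feedbackCost R' K')) :
    A - B * K = A - B * K' ∧ G = G' := by
  obtain ⟨p, hp, hpF⟩ := hF
  obtain ⟨p', hp', hpF'⟩ := id hF'
  obtain ⟨q, hq, hqG⟩ := h.antistable
  obtain ⟨q', hq', hqG'⟩ := h'.antistable
  have hrep := fun x hx => exists_flow_add_flow_of_mem_synthesis (x := x) hR' h'.inv_mul h'.sub_eq
    hF' h'.antistable hx
  rw [← synthesis_feedbackCost, ← hs] at hrep
  -- The products annihilate both stable, respectively both antistable, matrices. A pure flow of one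
  -- problem, decomposed in the other, therefore has no component of the opposite kind.
  have hco := (hp.mul hp').isCoprime (hq.mul hq')
  have e1 : aeval (A - B * K) (p * p') = 0 := by rw [map_mul, hpF, zero_mul]
  have e2 : aeval (A - B * K') (p * p') = 0 := by rw [map_mul, hpF', mul_zero]
  have e3 : aeval G (q * q') = 0 := by rw [map_mul, hqG, zero_mul]
  have e4 : aeval G' (q * q') = 0 := by rw [map_mul, hqG', mul_zero]
  constructor
  · apply Matrix.ext_of_mulVec_single
    intro i
    have hm := flow_mem_synthesis (F := A - B * K) (B := B) hR (Pi.single i 1)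
    rw [← synthesis_feedbackCost] at hm
    obtain ⟨a, b, hab⟩ := hrep _ hm
    exact (eq_zero_of_flow_eq_flow_add_flow hco e1 e2 e4 hab).2.2
  · apply Matrix.ext_of_mulVec_single
    intro i
    have hm := flow_mem_synthesis (F := G) (B := B) hR (Pi.single i 1)
    rw [← h.synthesis_eq hR] at hm
    obtain ⟨a, b, hab⟩ := hrep _ hm
    exact (eq_zero_of_flow_eq_flow_add_flow hco.symm e3 e4 e2
      (fun t ht => by rw [add_comm]; exact hab t ht)).2.2

end Gramian

/-! ### Block decompositions and idempotents. -/

section Blocks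

/-- A quotient of a controllable pair is controllable: the right inverse of `Z` makes `Zᵀ`
injective. -/
theorem IsKalman.of_intertwine {n m n' m' : ℕ} {A : Matrix (Fin n) (Fin n) ℝ}
    {B : Matrix (Fin n) (Fin m) ℝ} {A' : Matrix (Fin n') (Fin n') ℝ}
    {B' : Matrix (Fin n') (Fin m') ℝ} {Z : Matrix (Fin n') (Fin n) ℝ}
    {Z' : Matrix (Fin n) (Fin n') ℝ} {Y : Matrix (Fin m') (Fin m) ℝ} (h : IsKalman A B)
    (hA : Z * A = A' * Z) (hB : Z * B = B' * Y) (hZ : Z * Z' = 1) : IsKalman A' B' := by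
  rw [isKalman_iff] at h ⊢
  intro p hp
  have hAt : Aᵀ * Zᵀ = Zᵀ * A'ᵀ := by rw [← Matrix.transpose_mul, hA, Matrix.transpose_mul]
  have hBt : Bᵀ * Zᵀ = Yᵀ * B'ᵀ := by rw [← Matrix.transpose_mul, hB, Matrix.transpose_mul]
  have hk : ∀ k : ℕ, (Aᵀ) ^ k *ᵥ (Zᵀ *ᵥ p) = Zᵀ *ᵥ ((A'ᵀ) ^ k *ᵥ p) := by
    intro k
    induction k with
    | zero => simp
    | succ k ih =>
      rw [pow_succ', ← Matrix.mulVec_mulVec, ih, Matrix.mulVec_mulVec, hAt, pow_succ',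
        ← Matrix.mulVec_mulVec, ← Matrix.mulVec_mulVec]
  have h0 : Zᵀ *ᵥ p = 0 := by
    apply h
    intro k
    rw [hk, Matrix.mulVec_mulVec, hBt, ← Matrix.mulVec_mulVec, hp, Matrix.mulVec_zero]
  have h1 : (Z'ᵀ * Zᵀ) *ᵥ p = p := by
    rw [← Matrix.transpose_mul, hZ, Matrix.transpose_one, Matrix.one_mulVec]
  rw [← h1, ← Matrix.mulVec_mulVec, h0, Matrix.mulVec_zero]

variable {N n m : ℕ} {d : Fin N → ℕ} {h : ∑ i, d i = n} {d' : Fin N → ℕ} {h' : ∑ i, d' i = m}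

/-- The projection on the block `i₀`. -/
def blockProj (d : Fin N → ℕ) (h : ∑ i, d i = n) (i₀ : Fin N) : Matrix (Fin n) (Fin n) ℝ :=
  diagonal fun k => if ((blockEquiv d h).symm k).1 = i₀ then 1 else 0

theorem blockProj_mul_self (i₀ : Fin N) :
    blockProj d h i₀ * blockProj d h i₀ = blockProj d h i₀ := by
  simp [blockProj]

theorem blockProj_mul_reindex (i₀ : Fin N) (X : (i : Fin N) → Matrix (Fin (d i)) (Fin (d' i)) ℝ) :
    blockProj d h i₀ * Matrix.reindex (blockEquiv d h) (blockEquiv d' h') (blockDiagonal' X) =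
      Matrix.reindex (blockEquiv d h) (blockEquiv d' h') (blockDiagonal' X) *
        blockProj d' h' i₀ := by
  ext k l
  simp only [blockProj, diagonal_mul, mul_diagonal, Matrix.reindex_apply, Matrix.submatrix_apply,
    blockDiagonal'_apply]
  split_ifs <;> simp_all

theorem blockProj_ne_zero {i₀ : Fin N} (hi : 0 < d i₀) : blockProj d h i₀ ≠ 0 := by
  intro h0
  have := congrFun (congrFun h0 (blockEquiv d h ⟨i₀, ⟨0, hi⟩⟩)) (blockEquiv d h ⟨i₀, ⟨0, hi⟩⟩)
  simp [blockProj] at this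

theorem blockProj_ne_one {i₀ i₁ : Fin N} (hne : i₁ ≠ i₀) (hi : 0 < d i₁) :
    blockProj d h i₀ ≠ 1 := by
  intro h0
  have := congrFun (congrFun h0 (blockEquiv d h ⟨i₁, ⟨0, hi⟩⟩)) (blockEquiv d h ⟨i₁, ⟨0, hi⟩⟩)
  simp [blockProj, hne] at this

/-- The inclusion of the block `i`. -/
def blockIncl (d : Fin N → ℕ) (h : ∑ i, d i = n) (i : Fin N) : Matrix (Fin n) (Fin (d i)) ℝ :=
  (1 : Matrix (Fin n) (Fin n) ℝ).submatrix id fun a => blockEquiv d h ⟨i, a⟩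

/-- The diagonal block `i` of `X`. -/
def block (d : Fin N → ℕ) (h : ∑ i, d i = n) (d' : Fin N → ℕ) (h' : ∑ i, d' i = m)
    (X : Matrix (Fin n) (Fin m) ℝ) (i : Fin N) : Matrix (Fin (d i)) (Fin (d' i)) ℝ :=
  X.submatrix (fun a => blockEquiv d h ⟨i, a⟩) fun b => blockEquiv d' h' ⟨i, b⟩

/-- `X` vanishes outside the diagonal blocks. -/
def IsBlockDiag (d : Fin N → ℕ) (h : ∑ i, d i = n) (d' : Fin N → ℕ) (h' : ∑ i, d' i = m)
    (X : Matrix (Fin n) (Fin m) ℝ) : Prop :=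
  ∀ i j a b, i ≠ j → X (blockEquiv d h ⟨i, a⟩) (blockEquiv d' h' ⟨j, b⟩) = 0

variable {X : Matrix (Fin n) (Fin m) ℝ}

theorem IsBlockDiag.eq_reindex (hX : IsBlockDiag d h d' h' X) :
    X = Matrix.reindex (blockEquiv d h) (blockEquiv d' h') (blockDiagonal' (block d h d' h' X)) := by
  ext k l
  obtain ⟨⟨i, a⟩, rfl⟩ := (blockEquiv d h).surjective k
  obtain ⟨⟨j, b⟩, rfl⟩ := (blockEquiv d' h').surjective l
  simp only [Matrix.reindex_apply, Matrix.submatrix_apply, Equiv.symm_apply_apply]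
  by_cases hij : i = j
  · subst hij
    rw [blockDiagonal'_apply_eq]; rfl
  · rw [blockDiagonal'_apply_ne _ _ _ hij, hX _ _ _ _ hij]

theorem IsBlockDiag.transpose (hX : IsBlockDiag d h d' h' X) : IsBlockDiag d' h' d h Xᵀ :=
  fun i j a b hij => hX j i b a hij.symm

theorem IsBlockDiag.mul_blockIncl (hX : IsBlockDiag d h d' h' X) (i : Fin N) :
    X * blockIncl d' h' i = blockIncl d h i * block d h d' h' X i := by
  ext k b
  obtain ⟨⟨j, c⟩, rfl⟩ := (blockEquiv d h).surjective k
  have h1 : (X * blockIncl d' h' i) (blockEquiv d h ⟨j, c⟩) b =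
      X (blockEquiv d h ⟨j, c⟩) (blockEquiv d' h' ⟨i, b⟩) := by
    simp [blockIncl, Matrix.mul_apply, Matrix.one_apply]
  rw [h1, Matrix.mul_apply]
  simp only [blockIncl, Matrix.submatrix_apply, id, Matrix.one_apply,
    (blockEquiv d h).injective.eq_iff, block]
  by_cases hij : j = i
  · subst hij
    simp
  · rw [hX _ _ _ _ hij, Finset.sum_eq_zero]
    intro a _
    rw [if_neg (fun he => hij (congrArg Sigma.fst he)), zero_mul]

theorem IsBlockDiag.blockIncl_transpose_mul (hX : IsBlockDiag d h d' h' X) (i : Fin N) :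
    (blockIncl d h i)ᵀ * X = block d h d' h' X i * (blockIncl d' h' i)ᵀ := by
  have := congrArg Matrix.transpose (hX.transpose.mul_blockIncl i)
  rw [Matrix.transpose_mul, Matrix.transpose_mul, Matrix.transpose_transpose] at this
  exact this

theorem blockIncl_transpose_mul_self (i : Fin N) :
    (blockIncl d h i)ᵀ * blockIncl d h i = 1 := by
  ext a b
  simp [blockIncl, Matrix.mul_apply, Matrix.one_apply]

theorem IsBlockDiag.of_comm {d d' : Fin 2 → ℕ} {h : ∑ i, d i = n} {h' : ∑ i, d' i = m}
    (hX : blockProj d h 0 * X = X * blockProj d' h' 0) : IsBlockDiag d h d' h' X := by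
  intro i j a b hij
  have := congrFun (congrFun hX (blockEquiv d h ⟨i, a⟩)) (blockEquiv d' h' ⟨j, b⟩)
  simp only [blockProj, diagonal_mul, mul_diagonal, Equiv.symm_apply_apply] at this
  fin_cases i <;> fin_cases j <;> simp_all

/-- The columns of `M` are a basis adapted to range ⊕ kernel, the range being block 0. -/
theorem exists_blockProj_of_idempotent {P : Matrix (Fin n) (Fin n) ℝ} (hP : P * P = P) :
    ∃ (d : Fin 2 → ℕ) (h : ∑ i, d i = n) (M : Matrix.GeneralLinearGroup (Fin n) ℝ),
      P * M.val = M.val * blockProj d h 0 := by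
  have hid : IsIdempotentElem P.mulVecLin := by
    rw [IsIdempotentElem, Module.End.mul_eq_comp, ← Matrix.mulVecLin_mul, hP]
  let V : Fin 2 → Submodule ℝ (Fin n → ℝ) :=
    ![LinearMap.range P.mulVecLin, LinearMap.ker P.mulVecLin]
  have hV : DirectSum.IsInternal V := by
    rw [DirectSum.isInternal_submodule_iff_isCompl V (i := 0) (j := 1) (by decide)
      (by ext i; fin_cases i <;> simp)]
    exact (LinearMap.IsIdempotentElem.isCompl hid)
  let d : Fin 2 → ℕ := fun i => Module.finrank ℝ (V i)
  let b := hV.collectedBasis fun i => Module.finBasis ℝ (V i)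
  have h : ∑ i, d i = n := by
    have := Module.finrank_eq_card_basis b
    simpa [d] using this.symm
  let b' := b.reindex (blockEquiv d h)
  have hb' : ∀ j, P *ᵥ b' j = (if ((blockEquiv d h).symm j).1 = 0 then (1 : ℝ) else 0) • b' j := by
    intro j
    obtain ⟨⟨i, a⟩, rfl⟩ := (blockEquiv d h).surjective j
    have hmem := hV.collectedBasis_mem (fun i => Module.finBasis ℝ (V i)) ⟨i, a⟩
    have e : b' (blockEquiv d h ⟨i, a⟩) = b ⟨i, a⟩ := by simp [b']
    rw [e, Equiv.symm_apply_apply]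
    change b ⟨i, a⟩ ∈ V i at hmem
    generalize b ⟨i, a⟩ = v at hmem
    clear e
    change P *ᵥ v = (if i = 0 then (1 : ℝ) else 0) • v
    clear a
    fin_cases i
    · obtain ⟨w, rfl⟩ := hmem
      simp [hP]
    · have : P *ᵥ v = 0 := hmem
      simp [this]
  let M : Matrix (Fin n) (Fin n) ℝ := (Pi.basisFun ℝ (Fin n)).toMatrix b'
  let M' : Matrix (Fin n) (Fin n) ℝ := b'.toMatrix (Pi.basisFun ℝ (Fin n))
  refine ⟨d, h, ⟨M, M', Module.Basis.toMatrix_mul_toMatrix_flip _ _,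
    Module.Basis.toMatrix_mul_toMatrix_flip _ _⟩, ?_⟩
  change P * M = M * blockProj d h 0
  ext i j
  have h1 : (P * M) i j = (P *ᵥ b' j) i := by
    simp [Matrix.mul_apply, Matrix.mulVec, dotProduct, M, Module.Basis.toMatrix_apply]
  rw [h1, hb', blockProj, mul_diagonal]
  simp [M, Module.Basis.toMatrix_apply]

end Blocks

/-! ### Product structures as pairs of idempotents. -/

section Splitting

variable {n m : ℕ}

/-- Commuting idempotents that split the pair `(F, B)` and the quadratic form `R`. -/
structure IsSplitting (F : Matrix (Fin n) (Fin n) ℝ) (B : Matrix (Fin n) (Fin m) ℝ)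
    (R : Matrix (Fin m) (Fin m) ℝ) (P : Matrix (Fin n) (Fin n) ℝ)
    (E : Matrix (Fin m) (Fin m) ℝ) : Prop where
  idem_left : P * P = P
  idem_right : E * E = E
  comm : P * F = F * P
  intertwine : P * B = B * E
  symm : Eᵀ * R = R * E

variable {A : Matrix (Fin n) (Fin n) ℝ} {B : Matrix (Fin n) (Fin m) ℝ}
  {R : Matrix (Fin m) (Fin m) ℝ} {K : Matrix (Fin m) (Fin n) ℝ}

/-- Conjugates of the projections on block 0. `E` is neither 0 nor 1 because blocks 0 and 1 both
contain controls. -/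
theorem HasProductStructure.exists_isSplitting (h : HasProductStructure A B R K) :
    ∃ P E, IsSplitting (A - B * K) B R P E ∧ E ≠ 0 ∧ E ≠ 1 := by
  obtain ⟨N, M, U, hN, dn, dm, hn, hm, Ai, Bi, Ri, hi, hA, hB, hR⟩ := h
  have eF := blockProj_mul_reindex (h := hn) (h' := hn) ⟨0, by omega⟩ Ai
  have eB := blockProj_mul_reindex (h := hn) (h' := hm) ⟨0, by omega⟩ Bi
  have eR := blockProj_mul_reindex (h := hm) (h' := hm) ⟨0, by omega⟩ Ri
  have nz := blockProj_ne_zero (h := hm) (hi ⟨0, by omega⟩).1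
  have no := blockProj_ne_one (h := hm) (i₀ := ⟨0, by omega⟩) (i₁ := ⟨1, hN⟩) (by simp)
    (hi ⟨1, hN⟩).1
  have idn := blockProj_mul_self (h := hn) ⟨0, by omega⟩
  have idm := blockProj_mul_self (h := hm) ⟨0, by omega⟩
  have hDt : (blockProj dm hm ⟨0, by omega⟩)ᵀ = blockProj dm hm ⟨0, by omega⟩ := by
    simp [blockProj]
  rw [← hA] at eF
  rw [← hB] at eB
  rw [← hR] at eR
  set Dn := blockProj dn hn ⟨0, by omega⟩
  set Dm := blockProj dm hm ⟨0, by omega⟩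
  have m1 : M.val * (M⁻¹).val = 1 := M.mul_inv
  have m2 : (M⁻¹).val * M.val = 1 := M.inv_mul
  have u1 : U.val * (U⁻¹).val = 1 := U.mul_inv
  have u2 : (U⁻¹).val * U.val = 1 := U.inv_mul
  generalize (M⁻¹).val = M' at *
  generalize (U⁻¹).val = U' at *
  generalize M.val = M at *
  generalize U.val = U at *
  refine ⟨M * Dn * M', U * Dm * U', ⟨?_, ?_, ?_, ?_, ?_⟩, ?_, ?_⟩
  · calc M * Dn * M' * (M * Dn * M') = M * Dn * (M' * M) * Dn * M' := by
          simp only [Matrix.mul_assoc]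
      _ = M * (Dn * Dn) * M' := by rw [m2, mul_one]; simp only [Matrix.mul_assoc]
      _ = _ := by rw [idn]
  · calc U * Dm * U' * (U * Dm * U') = U * Dm * (U' * U) * Dm * U' := by
          simp only [Matrix.mul_assoc]
      _ = U * (Dm * Dm) * U' := by rw [u2, mul_one]; simp only [Matrix.mul_assoc]
      _ = _ := by rw [idm]
  · calc M * Dn * M' * (A - B * K) = M * Dn * M' * (A - B * K) * (M * M') := by rw [m1, mul_one]
      _ = M * (Dn * (M' * (A - B * K) * M)) * M' := by simp only [Matrix.mul_assoc]
      _ = M * M' * (A - B * K) * (M * Dn * M') := by rw [eF]; simp only [Matrix.mul_assoc]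
      _ = _ := by rw [m1, one_mul]
  · calc M * Dn * M' * B = M * Dn * M' * B * (U * U') := by rw [u1, Matrix.mul_one]
      _ = M * (Dn * (M' * B * U)) * U' := by simp only [Matrix.mul_assoc]
      _ = M * M' * B * (U * Dm * U') := by rw [eB]; simp only [Matrix.mul_assoc]
      _ = _ := by rw [m1, Matrix.one_mul]
  · have ut : U'ᵀ * Uᵀ = 1 := by rw [← Matrix.transpose_mul, u1, Matrix.transpose_one]
    calc (U * Dm * U')ᵀ * R = U'ᵀ * Dm * Uᵀ * R * (U * U') := by
          rw [u1, mul_one, Matrix.transpose_mul, Matrix.transpose_mul, hDt]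
          simp only [Matrix.mul_assoc]
      _ = U'ᵀ * (Dm * (Uᵀ * R * U)) * U' := by simp only [Matrix.mul_assoc]
      _ = U'ᵀ * Uᵀ * R * (U * Dm * U') := by rw [eR]; simp only [Matrix.mul_assoc]
      _ = _ := by rw [ut, one_mul]
  · intro h0
    apply nz
    calc Dm = U' * U * Dm * (U' * U) := by rw [u2, one_mul, mul_one]
      _ = U' * (U * Dm * U') * U := by simp only [Matrix.mul_assoc]
      _ = 0 := by rw [h0]; simp
  · intro h0
    apply no
    calc Dm = U' * U * Dm * (U' * U) := by rw [u2, one_mul, mul_one]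
      _ = U' * (U * Dm * U') * U := by simp only [Matrix.mul_assoc]
      _ = 1 := by rw [h0, mul_one, u2]

/-- In bases adapted to `P` and `E`, the commutation relations say block diagonal. Both control
blocks are nonempty since `E ≠ 0, 1`; injectivity of `B` gives `mᵢ ≤ nᵢ`; controllability passes to
the blocks as quotients. -/
theorem IsSplitting.hasProductStructure {P : Matrix (Fin n) (Fin n) ℝ}
    {E : Matrix (Fin m) (Fin m) ℝ} (h : IsSplitting (A - B * K) B R P E) (hE0 : E ≠ 0)
    (hE1 : E ≠ 1) (hR : R.PosDef) (hB : Function.Injective B.mulVec)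
    (hAB : IsKalman (A - B * K) B) : HasProductStructure A B R K := by
  obtain ⟨dn, hn, M, hM⟩ := exists_blockProj_of_idempotent h.idem_left
  obtain ⟨dm, hm, U, hU⟩ := exists_blockProj_of_idempotent h.idem_right
  have m1 : M.val * (M⁻¹).val = 1 := M.mul_inv
  have m2 : (M⁻¹).val * M.val = 1 := M.inv_mul
  have u1 : U.val * (U⁻¹).val = 1 := U.mul_inv
  have u2 : (U⁻¹).val * U.val = 1 := U.inv_mul
  refine ⟨2, M, U, one_lt_two, dn, dm, hn, hm, ?_⟩
  generalize (M⁻¹).val = M' at *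
  generalize (U⁻¹).val = U' at *
  generalize M.val = M at *
  generalize U.val = U at *
  have hDt : (blockProj dm hm 0)ᵀ = blockProj dm hm 0 := by simp [blockProj]
  have hM' : blockProj dn hn 0 * M' = M' * P := by
    calc blockProj dn hn 0 * M' = M' * (M * blockProj dn hn 0) * M' := by
          rw [← Matrix.mul_assoc, m2, one_mul]
      _ = M' * P * (M * M') := by rw [← hM]; simp only [Matrix.mul_assoc]
      _ = _ := by rw [m1, mul_one]
  have hUt : blockProj dm hm 0 * Uᵀ = Uᵀ * Eᵀ := by
    rw [← Matrix.transpose_mul, hU, Matrix.transpose_mul, hDt]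
  have dF : IsBlockDiag dn hn dn hn (M' * (A - B * K) * M) := by
    apply IsBlockDiag.of_comm
    rw [← Matrix.mul_assoc, ← Matrix.mul_assoc, hM', Matrix.mul_assoc M' P, h.comm,
      Matrix.mul_assoc _ M, ← hM]
    simp only [Matrix.mul_assoc]
  have dB : IsBlockDiag dn hn dm hm (M' * B * U) := by
    apply IsBlockDiag.of_comm
    rw [← Matrix.mul_assoc, ← Matrix.mul_assoc, hM', Matrix.mul_assoc M' P, h.intertwine,
      Matrix.mul_assoc _ U, ← hU]
    simp only [Matrix.mul_assoc]
  have dR : IsBlockDiag dm hm dm hm (Uᵀ * R * U) := by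
    apply IsBlockDiag.of_comm
    rw [← Matrix.mul_assoc, ← Matrix.mul_assoc, hUt, Matrix.mul_assoc Uᵀ Eᵀ, h.symm,
      Matrix.mul_assoc _ U, ← hU]
    simp only [Matrix.mul_assoc]
  refine ⟨block dn hn dn hn (M' * (A - B * K) * M), block dn hn dm hm (M' * B * U),
    block dm hm dm hm (Uᵀ * R * U), fun i => ⟨?_, ?_, ?_, ?_⟩, dF.eq_reindex, dB.eq_reindex,
    dR.eq_reindex⟩
  · by_contra hd
    have hEd : E = U * blockProj dm hm 0 * U' := by rw [← hU, Matrix.mul_assoc, u1, mul_one]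
    have hne : ∀ k, ((blockEquiv dm hm).symm k).1 ≠ i := by
      intro k hk
      have := ((blockEquiv dm hm).symm k).2.2
      exact absurd (lt_of_le_of_lt (Nat.zero_le _) this) (hk ▸ hd)
    fin_cases i
    · apply hE0
      have : blockProj dm hm 0 = 0 := by
        rw [blockProj, ← Matrix.diagonal_zero]
        congr 1
        ext k
        exact if_neg (hne k)
      rw [hEd, this, mul_zero, zero_mul]
    · apply hE1
      have : blockProj dm hm 0 = 1 := by
        rw [blockProj, ← Matrix.diagonal_one]
        congr 1
        ext k
        have hk := hne k
        simp only [Fin.mk_one, ne_eq] at hk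
        exact if_pos (by omega)
      rw [hEd, this, mul_one, u1]
  · have hinj : Function.Injective (block dn hn dm hm (M' * B * U) i).mulVec := by
      intro v w hvw
      have h1 : ∀ v, (blockIncl dn hn i) *ᵥ (block dn hn dm hm (M' * B * U) i *ᵥ v) =
          M' *ᵥ B *ᵥ U *ᵥ blockIncl dm hm i *ᵥ v := by
        intro v
        rw [Matrix.mulVec_mulVec, ← dB.mul_blockIncl]
        simp only [Matrix.mulVec_mulVec, Matrix.mul_assoc]
      have h2 : M' *ᵥ B *ᵥ U *ᵥ blockIncl dm hm i *ᵥ v =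
          M' *ᵥ B *ᵥ U *ᵥ blockIncl dm hm i *ᵥ w := by
        rw [← h1, ← h1]; exact congrArg _ hvw
      have h3 := congrArg (fun z => M *ᵥ z) h2
      simp only [Matrix.mulVec_mulVec _ M M', m1, Matrix.one_mulVec] at h3
      have h4 := congrArg (fun z => U' *ᵥ z) (hB h3)
      simp only [Matrix.mulVec_mulVec _ U' U, u2, Matrix.one_mulVec] at h4
      have h5 := congrArg (fun z => (blockIncl dm hm i)ᵀ *ᵥ z) h4
      simpa only [Matrix.mulVec_mulVec, blockIncl_transpose_mul_self, Matrix.one_mulVec] using h5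
    have := LinearMap.finrank_le_finrank_of_injective
      (f := (block dn hn dm hm (M' * B * U) i).mulVecLin) hinj
    simpa using this
  · refine hAB.of_intertwine (Z := (blockIncl dn hn i)ᵀ * M') (Z' := M * blockIncl dn hn i)
      (Y := (blockIncl dm hm i)ᵀ * U') ?_ ?_ ?_
    · rw [← Matrix.mul_assoc, ← dF.blockIncl_transpose_mul]
      simp only [Matrix.mul_assoc, m1, mul_one]
    · rw [← Matrix.mul_assoc, ← dB.blockIncl_transpose_mul]
      simp only [Matrix.mul_assoc, u1, Matrix.mul_one]
    · rw [Matrix.mul_assoc, ← Matrix.mul_assoc M', m2, Matrix.one_mul,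
        blockIncl_transpose_mul_self]
  · have h1 : block dm hm dm hm (Uᵀ * R * U) i =
        (U * blockIncl dm hm i)ᴴ * R * (U * blockIncl dm hm i) := by
      have := dR.mul_blockIncl i
      rw [Matrix.conjTranspose_eq_transpose_of_trivial, Matrix.transpose_mul]
      calc _ = ((blockIncl dm hm i)ᵀ * blockIncl dm hm i) * block dm hm dm hm (Uᵀ * R * U) i := by
            rw [blockIncl_transpose_mul_self, one_mul]
        _ = _ := by rw [Matrix.mul_assoc, ← this]; simp only [Matrix.mul_assoc]
    rw [h1]
    apply hR.conjTranspose_mul_mul_same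
    intro v w hvw
    have h4 := congrArg (fun z => U' *ᵥ z) hvw
    simp only [← Matrix.mulVec_mulVec] at h4
    simp only [Matrix.mulVec_mulVec _ U' U, u2, Matrix.one_mulVec] at h4
    have h5 := congrArg (fun z => (blockIncl dm hm i)ᵀ *ᵥ z) h4
    simpa only [Matrix.mulVec_mulVec, blockIncl_transpose_mul_self, Matrix.one_mulVec] using h5

end Splitting

/-! ### Spectral projections of `R'⁻¹ R`. -/

section Diagonalization

variable {n m : ℕ}

-- With `R' = Lᵀ L`, the matrix `R'⁻¹ R` is conjugate by `L` to the symmetric matrix `L⁻ᵀ R L⁻¹`.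
open scoped MatrixOrder Matrix.Norms.L2Operator in
theorem exists_diagonalization {R R' : Matrix (Fin m) (Fin m) ℝ} (hR : Rᵀ = R)
    (hR' : R'.PosDef) : ∃ (T : Matrix (Fin m) (Fin m) ℝ) (μ : Fin m → ℝ), IsUnit T ∧
      R'⁻¹ * R * T = T * diagonal μ := by
  obtain ⟨L, hL⟩ := CStarAlgebra.nonneg_iff_eq_star_mul_self.mp hR'.posSemidef.nonneg
  rw [Matrix.star_eq_conjTranspose, Matrix.conjTranspose_eq_transpose_of_trivial] at hL
  have hLu : IsUnit L.det := by
    have := isUnit_det_of_posDef hR'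
    rw [hL, Matrix.det_mul] at this
    exact isUnit_of_mul_isUnit_right this
  have hLt : IsUnit Lᵀ.det := by rwa [Matrix.det_transpose]
  have hS : (L⁻¹ᵀ * R * L⁻¹).IsHermitian := by
    rw [Matrix.IsHermitian, Matrix.conjTranspose_eq_transpose_of_trivial, Matrix.transpose_mul,
      Matrix.transpose_mul, Matrix.transpose_transpose, hR, Matrix.mul_assoc]
  set V : Matrix (Fin m) (Fin m) ℝ := hS.eigenvectorUnitary.1 with hV
  have hVu : IsUnit V := by
    refine ⟨⟨V, star V, ?_, ?_⟩, rfl⟩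
    · exact Unitary.coe_mul_star_self _
    · exact Unitary.coe_star_mul_self _
  have hSV : L⁻¹ᵀ * R * L⁻¹ * V = V * diagonal hS.eigenvalues := by
    apply Matrix.ext_of_mulVec_single
    intro j
    rw [← Matrix.mulVec_mulVec, hV, hS.eigenvectorUnitary_mulVec, hS.mulVec_eigenvectorBasis,
      ← Matrix.mulVec_mulVec, Matrix.diagonal_mulVec_single, mul_one,
      ← hS.eigenvectorUnitary_mulVec, ← Matrix.mulVec_smul]
    congr 1
    ext k
    simp [Pi.single_apply]
  refine ⟨L⁻¹ * V, hS.eigenvalues, ?_, ?_⟩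
  · exact ((Matrix.isUnit_iff_isUnit_det _).mpr (Matrix.isUnit_nonsing_inv_det _ hLu)).mul hVu
  · have h1 : R'⁻¹ = L⁻¹ * L⁻¹ᵀ := by
      rw [hL, Matrix.mul_inv_rev, Matrix.transpose_nonsing_inv]
    rw [h1, Matrix.mul_assoc L⁻¹ V, ← hSV]
    simp only [Matrix.mul_assoc]

theorem aeval_diagonal (μ : Fin m → ℝ) (f : ℝ[X]) :
    aeval (diagonal μ) f = diagonal fun i => f.eval (μ i) := by
  have h1 := (Polynomial.aeval_algHom_apply (Matrix.diagonalAlgHom ℝ) μ f)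
  have h2 : aeval μ f = fun i => f.eval (μ i) := by
    ext i
    rw [Polynomial.aeval_pi_apply₂, Polynomial.coe_aeval_eq_eval]
  rw [h2] at h1
  exact h1

/-- A nonscalar diagonalizable matrix has a nontrivial polynomial spectral projection. -/
theorem exists_aeval_idempotent {Δ T : Matrix (Fin m) (Fin m) ℝ} {μ : Fin m → ℝ}
    (hT : IsUnit T) (hΔ : Δ * T = T * diagonal μ) (hns : ∀ s : ℝ, Δ ≠ s • 1) :
    ∃ f : ℝ[X], aeval Δ (f * f - f) = 0 ∧ aeval Δ f ≠ 0 ∧ aeval Δ f ≠ 1 := by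
  obtain ⟨i, j, hij⟩ : ∃ i j, μ i ≠ μ j := by
    by_contra! h
    rcases isEmpty_or_nonempty (Fin m) with he | ⟨⟨i⟩⟩
    · exact hns 0 (Subsingleton.elim _ _)
    · apply hns (μ i)
      have h1 : diagonal μ = μ i • (1 : Matrix (Fin m) (Fin m) ℝ) := by
        rw [← Matrix.diagonal_one, ← Matrix.diagonal_smul]
        congr 1
        ext j
        simp [h j i]
      rw [h1, mul_smul_comm, mul_one] at hΔ
      apply hT.mul_right_cancel
      rw [hΔ, smul_mul_assoc, one_mul]
  let s : Finset ℝ := Finset.univ.image μ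
  have hmem : ∀ k, μ k ∈ s := fun k => Finset.mem_image_of_mem _ (Finset.mem_univ k)
  -- `f` is 1 at the eigenvalue `μ i` and 0 at all others; taking the image `s` as node set removes
  -- repetitions.
  let f : ℝ[X] := Lagrange.basis s id (μ i)
  have hfi : f.eval (μ i) = 1 := Lagrange.eval_basis_self (v := id) (Set.injOn_id _) (hmem i)
  have hfj : ∀ k, μ k ≠ μ i → f.eval (μ k) = 0 := fun k hk =>
    Lagrange.eval_basis_of_ne (v := id) hk.symm (hmem k)
  have key : ∀ g : ℝ[X], aeval Δ g * T = T * diagonal fun i => g.eval (μ i) := fun g => by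
    rw [aeval_mul_comm_of_comm hΔ, aeval_diagonal]
  refine ⟨f, ?_, ?_, ?_⟩
  · apply hT.mul_right_cancel
    rw [key, zero_mul]
    have : (fun k => (f * f - f).eval (μ k)) = 0 := by
      ext k
      by_cases hk : μ k = μ i
      · simp [hk, hfi]
      · simp [hfj k hk]
    rw [this, Matrix.diagonal_zero', mul_zero]
  · intro h0
    have h1 := key f
    rw [h0, zero_mul] at h1
    have h2 := hT.mul_left_cancel (h1.symm.trans (mul_zero T).symm)
    have h3 := congrFun (congrFun h2 i) i
    simp [hfi] at h3
  · intro h0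
    have h1 := key f
    rw [h0, one_mul] at h1
    have h2 := hT.mul_left_cancel (h1.symm.trans (mul_one T).symm)
    have h3 := congrFun (congrFun h2 j) j
    simp [hfj j hij.symm] at h3

/-- `M F^k B = F^k M B = 0`, so `M` kills the whole reachable space. This carries polynomial
identities from the control side to the state side. -/
theorem IsKalman.eq_zero_of_mul_eq_zero {F M : Matrix (Fin n) (Fin n) ℝ}
    {B : Matrix (Fin n) (Fin m) ℝ} (h : IsKalman F B) (hF : M * F = F * M) (hB : M * B = 0) :
    M = 0 := by
  have hFt : Fᵀ * Mᵀ = Mᵀ * Fᵀ := by rw [← Matrix.transpose_mul, hF, Matrix.transpose_mul]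
  have h0 : ∀ q, Mᵀ *ᵥ q = 0 := by
    intro q
    refine h.eq_zero (LinearMap.range Mᵀ.mulVecLin) ?_ ?_ ⟨q, rfl⟩
    · rintro _ ⟨q, rfl⟩
      rw [Matrix.mulVecLin_apply, Matrix.mulVec_mulVec, ← Matrix.transpose_mul, hB,
        Matrix.transpose_zero, Matrix.zero_mulVec]
    · rintro _ ⟨q, rfl⟩
      refine ⟨Fᵀ *ᵥ q, ?_⟩
      simp only [Matrix.mulVecLin_apply, Matrix.mulVec_mulVec, hFt]
  have h1 : Mᵀ = 0 := Matrix.ext_of_mulVec_single fun i => by rw [h0, Matrix.zero_mulVec]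
  rw [← Matrix.transpose_transpose M, h1, Matrix.transpose_zero]

end Diagonalization

/-! ### Reweighting the blocks of a split cost. -/

section SplitSynthesis

variable {n m : ℕ} {F P : Matrix (Fin n) (Fin n) ℝ} {B : Matrix (Fin n) (Fin m) ℝ}
  {R E : Matrix (Fin m) (Fin m) ℝ}

theorem IsSplitting.compl (h : IsSplitting F B R P E) :
    IsSplitting F B R (1 - P) (1 - E) where
  idem_left := by
    rw [Matrix.sub_mul, Matrix.mul_sub, Matrix.mul_sub, h.idem_left]; simp
  idem_right := by
    rw [Matrix.sub_mul, Matrix.mul_sub, Matrix.mul_sub, h.idem_right]; simp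
  comm := by rw [Matrix.sub_mul, Matrix.mul_sub, h.comm]; simp
  intertwine := by rw [Matrix.sub_mul, Matrix.mul_sub, h.intertwine]; simp
  symm := by
    rw [Matrix.transpose_sub, Matrix.transpose_one, Matrix.sub_mul, Matrix.mul_sub, h.symm]; simp

/-- Along a minimizer for `R`, the part of the cost in the range of `E` is minimal. -/
theorem IsSplitting.integral_le (h : IsSplitting F B R P E) {t₀ t₁ : ℝ}
    (hle : t₀ ≤ t₁) {x y : ℝ → Fin n → ℝ} {w v : ℝ → Fin m → ℝ}
    (hx : IsTrajectory F B t₀ t₁ x w)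
    (hmin : ∀ (y : ℝ → Fin n → ℝ) (v : ℝ → Fin m → ℝ), IsTrajectory F B t₀ t₁ y v →
      y t₀ = x t₀ → y t₁ = x t₁ →
      ∫ t in t₀..t₁, controlCost n R (x t) (w t) ≤ ∫ t in t₀..t₁, controlCost n R (y t) (v t))
    (hy : IsTrajectory F B t₀ t₁ y v) (h0 : y t₀ = x t₀) (h1 : y t₁ = x t₁) :
    ∫ t in t₀..t₁, w t ⬝ᵥ (R * E) *ᵥ w t ≤ ∫ t in t₀..t₁, v t ⬝ᵥ (R * E) *ᵥ v t := by
  -- The competitor follows `y` in the range of `P` and `x` in the range of `1 - P`, so only the `E`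
  -- part of the cost is compared.
  have hz := (hy.map h.comm h.intertwine).add (hx.map h.compl.comm h.compl.intertwine)
  have hPx : ∀ z : Fin n → ℝ, P *ᵥ z + (1 - P) *ᵥ z = z := by
    intro z; rw [← Matrix.add_mulVec]; simp
  have hcost := hmin _ _ hz (by rw [h0, hPx]) (by rw [h1, hPx])
  have sw : ∀ (M N : Matrix (Fin m) (Fin m) ℝ) (a b : Fin m → ℝ),
      (M *ᵥ a) ⬝ᵥ R *ᵥ (N *ᵥ b) = a ⬝ᵥ (Mᵀ * R * N) *ᵥ b := by
    intro M N a b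
    rw [← Matrix.mulVec_mulVec, ← Matrix.mulVec_mulVec, Matrix.dotProduct_mulVec a,
      ← Matrix.mulVec_transpose, Matrix.transpose_transpose]
  have c1 : Eᵀ * R * E = R * E := by rw [h.symm, Matrix.mul_assoc, h.idem_right]
  have c2 : Eᵀ * R * (1 - E) = 0 := by rw [Matrix.mul_sub, c1, h.symm]; simp
  have c3 : (1 - E)ᵀ * R * E = 0 := by
    rw [Matrix.transpose_sub, Matrix.transpose_one, Matrix.sub_mul, Matrix.sub_mul, c1]; simp
  have c4 : (1 - E)ᵀ * R * (1 - E) = R * (1 - E) := by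
    rw [h.compl.symm, Matrix.mul_assoc, h.compl.idem_right]
  have e1 : ∀ t, controlCost n R (P *ᵥ y t + (1 - P) *ᵥ x t) (E *ᵥ v t + (1 - E) *ᵥ w t) =
      v t ⬝ᵥ (R * E) *ᵥ v t + w t ⬝ᵥ (R * (1 - E)) *ᵥ w t := by
    intro t
    simp only [controlCost, Matrix.mulVec_add, add_dotProduct, dotProduct_add, sw, c1, c2, c3, c4,
      Matrix.zero_mulVec, dotProduct_zero]
    ring
  have e2 : ∀ t, controlCost n R (x t) (w t) =
      w t ⬝ᵥ (R * E) *ᵥ w t + w t ⬝ᵥ (R * (1 - E)) *ᵥ w t := by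
    intro t
    rw [controlCost, ← dotProduct_add, ← Matrix.add_mulVec, ← Matrix.mul_add]
    simp
  simp only [e1, e2] at hcost
  rw [intervalIntegral.integral_add, intervalIntegral.integral_add] at hcost
  · linarith
  all_goals first
    | exact intervalIntegrable_bilinear hle hy.memLp hy.memLp _
    | exact intervalIntegrable_bilinear hle hx.memLp hx.memLp _

/-- A minimizer for `R` minimizes each of the two parts separately, hence every nonnegative
combination of them. -/
theorem IsSplitting.synthesis_subset (h : IsSplitting F B R P E)
    {R' : Matrix (Fin m) (Fin m) ℝ} {α β : ℝ} (hα : 0 ≤ α) (hβ : 0 ≤ β)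
    (hR' : R' = α • (R * E) + β • (R * (1 - E))) :
    synthesis F B (controlCost n R) ⊆ synthesis F B (controlCost n R') := by
  rintro ⟨t₀, t₁, x⟩ ⟨ht, w, hw, hmin⟩
  change t₀ < t₁ at ht
  refine ⟨ht, w, hw, fun y v hv h0 h1 => ?_⟩
  have i1 := h.integral_le ht.le hw hmin hv h0 h1
  have i2 := h.compl.integral_le ht.le hw hmin hv h0 h1
  have e : ∀ {x : ℝ → Fin n → ℝ} {w : ℝ → Fin m → ℝ}, IsTrajectory F B t₀ t₁ x w →
      ∫ t in t₀..t₁, controlCost n R' (x t) (w t) =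
        α * (∫ t in t₀..t₁, w t ⬝ᵥ (R * E) *ᵥ w t) +
        β * ∫ t in t₀..t₁, w t ⬝ᵥ (R * (1 - E)) *ᵥ w t := by
    intro x w hw
    rw [← intervalIntegral.integral_const_mul, ← intervalIntegral.integral_const_mul,
      ← intervalIntegral.integral_add]
    · simp [controlCost, hR', Matrix.add_mulVec, Matrix.smul_mulVec, dotProduct_add,
        dotProduct_smul]
    · exact (intervalIntegrable_bilinear ht.le hw.memLp hw.memLp _).const_mul _
    · exact (intervalIntegrable_bilinear ht.le hw.memLp hw.memLp _).const_mul _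
  change ∫ t in t₀..t₁, controlCost n R' (x t) (w t) ≤ _
  rw [e hw, e hv]
  exact add_le_add (mul_le_mul_of_nonneg_left i1 hα) (mul_le_mul_of_nonneg_left i2 hβ)

theorem IsSplitting.synthesis_add_eq (h : IsSplitting F B R P E) :
    synthesis F B (controlCost n (R + R * E)) = synthesis F B (controlCost n R) := by
  have hRE : R * E * E = R * E := by rw [Matrix.mul_assoc, h.idem_right]
  apply Set.Subset.antisymm
  · have h' : IsSplitting F B (R + R * E) P E :=
      ⟨h.idem_left, h.idem_right, h.comm, h.intertwine, by
        rw [Matrix.mul_add, h.symm, ← Matrix.mul_assoc, h.symm, Matrix.add_mul]⟩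
    -- The `E` part of `R + R E` is `2 R E`; weight `1 / 2` recovers `R`.
    refine h'.synthesis_subset (α := 1 / 2) (β := 1) (by norm_num) (by norm_num) ?_
    rw [Matrix.mul_sub, Matrix.mul_one, Matrix.add_mul, hRE, ← two_smul ℝ (R * E), smul_smul]
    simp [two_smul]
  · refine h.synthesis_subset (α := 2) (β := 1) (by norm_num) (by norm_num) ?_
    rw [Matrix.mul_sub, Matrix.mul_one, two_smul, one_smul]
    abel

theorem IsSplitting.posDef_add (h : IsSplitting F B R P E) (hR : R.PosDef) :
    (R + R * E).PosDef := by
  have h1 : R * E = Eᴴ * R * E := by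
    rw [Matrix.conjTranspose_eq_transpose_of_trivial, h.symm, Matrix.mul_assoc, h.idem_right]
  have h2 : (R * E).PosSemidef := by
    rw [h1]; exact hR.posSemidef.conjTranspose_mul_mul_same E
  exact hR.add_posSemidef h2

end SplitSynthesis

/-! ### Existence and uniqueness of the canonical cost. -/

section Canonical

variable {n m : ℕ} {A : Matrix (Fin n) (Fin n) ℝ} {B : Matrix (Fin n) (Fin m) ℝ}
  {R R' : Matrix (Fin m) (Fin m) ℝ} {K K' : Matrix (Fin m) (Fin n) ℝ}

theorem exists_smul_det_eq_one (hR : R.PosDef) : ∃ c : ℝ, 0 < c ∧ (c • R).det = 1 := by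
  rcases Nat.eq_zero_or_pos m with rfl | hm
  · exact ⟨1, one_pos, Matrix.det_isEmpty⟩
  · have hd := hR.det_pos
    refine ⟨(R.det⁻¹) ^ ((m : ℝ)⁻¹), Real.rpow_pos_of_pos (inv_pos.mpr hd) _, ?_⟩
    rw [Matrix.det_smul, Fintype.card_fin, Real.rpow_inv_natCast_pow (inv_pos.mpr hd).le hm.ne',
      inv_mul_cancel₀ hd.ne']

theorem eq_of_feedbackCost_eq (hR : Rᵀ = R) (hR' : R'ᵀ = R')
    (h : feedbackCost R K = feedbackCost R' K') : R = R' := by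
  have h1 : ∀ u : Fin m → ℝ, u ⬝ᵥ R *ᵥ u = u ⬝ᵥ R' *ᵥ u := by
    intro u
    have := congrFun (congrFun h 0) u
    simpa [feedbackCost] using this
  have sw : ∀ {M : Matrix (Fin m) (Fin m) ℝ}, Mᵀ = M → ∀ a b, a ⬝ᵥ M *ᵥ b = b ⬝ᵥ M *ᵥ a := by
    intro M hM a b
    rw [Matrix.dotProduct_mulVec, ← Matrix.mulVec_transpose, hM, dotProduct_comm]
  apply Matrix.ext_of_mulVec_single
  intro i
  apply dotProduct_eq
  intro b
  have h2 := h1 (Pi.single i 1 + b)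
  simp only [Matrix.mulVec_add, add_dotProduct, dotProduct_add, h1 (Pi.single i 1), h1 b,
    sw hR b, sw hR' b] at h2
  rw [dotProduct_comm, dotProduct_comm (R' *ᵥ _), sw hR b, sw hR' b]
  linarith

theorem mulVec_injective_of_rank (hB : B.rank = m) : Function.Injective B.mulVec := by
  have h1 := LinearMap.finrank_range_add_finrank_ker B.mulVecLin
  rw [Matrix.rank] at hB
  rw [hB, Module.finrank_fintype_fun_eq_card, Fintype.card_fin] at h1
  have h2 : Module.finrank ℝ (LinearMap.ker B.mulVecLin) = 0 := by omega
  exact LinearMap.ker_eq_bot.mp (Submodule.finrank_eq_zero.mp h2)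

theorem mul_left_cancel_of_injective {k : ℕ} (hB : Function.Injective B.mulVec)
    {X Y : Matrix (Fin m) (Fin k) ℝ} (h : B * X = B * Y) : X = Y := by
  apply Matrix.ext_of_mulVec_single
  intro i
  apply hB
  rw [Matrix.mulVec_mulVec, Matrix.mulVec_mulVec, h]

theorem exists_canonicalPair (hAB : IsKalman A B) {Γ : Set (ℝ × ℝ × (ℝ → Fin n → ℝ))}
    (hΓ : IsLQSynthesis A B Γ) :
    ∃ R K, IsCanonicalPair A B R K ∧ synthesis A B (feedbackCost R K) = Γ := by
  obtain ⟨Q, S, R, ⟨hQ, hR, hH⟩, rfl⟩ := hΓ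
  have hRt := transpose_eq_of_posDef hR
  have hRi : R⁻¹ᵀ = R⁻¹ := transpose_eq_of_posDef hR.inv
  have hRu := isUnit_det_of_posDef hR
  obtain ⟨p, q, hp, hq, hpq⟩ := exists_hurwitz_mul_antiHurwitz
    (hamiltonianMatrix A B Q S R).charpoly fun z hz => hH z ((mem_spectrum_map_iff _ z).mpr hz)
  have h0 : aeval (hamiltonianMatrix A B Q S R) (p * q) = 0 := by
    rw [← hpq, Matrix.aeval_self_charpoly]
  have hHe : hamiltonianMatrix A B Q S R = fromBlocks (A - B * (R⁻¹ * Sᵀ)) (B * R⁻¹ * Bᵀ)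
      (Q - S * R⁻¹ * Sᵀ) (-(A - B * (R⁻¹ * Sᵀ))ᵀ) := by
    rw [hamiltonianMatrix, Matrix.transpose_sub, Matrix.transpose_mul, Matrix.transpose_mul, hRi,
      Matrix.transpose_transpose, Matrix.mul_assoc B, neg_sub, sub_eq_neg_add, add_comm]
    congr 1
    abel
  rw [hHe] at h0
  have hQt : (Q - S * R⁻¹ * Sᵀ)ᵀ = Q - S * R⁻¹ * Sᵀ := by
    rw [Matrix.transpose_sub, Matrix.transpose_mul, Matrix.transpose_mul, hRi,
      Matrix.transpose_transpose, Matrix.mul_assoc S, show Qᵀ = Q from hQ]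
  -- The preliminary feedback `R⁻¹ Sᵀ` removes the cross term `S`.
  obtain ⟨P, hP, hric, hst⟩ := exists_stabilizing_riccati (hAB.sub_mul (R⁻¹ * Sᵀ)) hR hQt hp hq h0
  have hF : A - B * (R⁻¹ * (Sᵀ - Bᵀ * P)) = A - B * (R⁻¹ * Sᵀ) + B * R⁻¹ * Bᵀ * P := by
    simp only [Matrix.mul_sub, Matrix.mul_assoc]
    abel
  have hRK : R * (R⁻¹ * (Sᵀ - Bᵀ * P)) = Sᵀ - Bᵀ * P :=
    Matrix.mul_nonsing_inv_cancel_left _ _ hRu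
  have hs := synthesis_quadCost_eq (A := A) (B := B) (Q := Q) (S := S) hP hRt hRK (by
    rw [Matrix.mul_assoc, hRK, Matrix.transpose_mul, Matrix.transpose_sub, Matrix.transpose_mul,
      Matrix.transpose_transpose, Matrix.transpose_transpose, hP, hRi]
    rw [sub_eq_iff_eq_add] at hric
    rw [hric]
    simp only [Matrix.transpose_sub, Matrix.transpose_mul, Matrix.transpose_transpose, hRi,
      Matrix.sub_mul, Matrix.mul_sub, Matrix.mul_assoc]
    abel)
  obtain ⟨c, hc, hdet⟩ := exists_smul_det_eq_one hR
  refine ⟨c • R, R⁻¹ * (Sᵀ - Bᵀ * P), ⟨hR.smul hc, hdet, ?_⟩, ?_⟩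
  · rw [isAsymptoticallyStable_iff, hF]
    exact hst
  · rw [synthesis_feedbackCost_smul _ _ hc, hs]

/-- A product structure yields a second canonical cost with the same synthesis. -/
theorem exists_ne_of_hasProductStructure (h : IsCanonicalPair A B R K)
    (hp : HasProductStructure A B R K) :
    ∃ R', IsCanonicalPair A B R' K ∧ feedbackCost R' K ≠ feedbackCost R K ∧
      synthesis A B (feedbackCost R' K) = synthesis A B (feedbackCost R K) := by
  obtain ⟨P, E, hs, hE0, hE1⟩ := hp.exists_isSplitting
  have hR1 := hs.posDef_add h.posDef
  obtain ⟨c, hc, hdet⟩ := exists_smul_det_eq_one hR1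
  have hR2 : (c • (R + R * E)).PosDef := hR1.smul hc
  refine ⟨c • (R + R * E), ⟨hR2, hdet, h.stable⟩, ?_, ?_⟩
  · intro heq
    have h1 := eq_of_feedbackCost_eq (transpose_eq_of_posDef hR2)
      (transpose_eq_of_posDef h.posDef) heq
    -- Equal costs would make the idempotent `E` scalar, hence 0 or 1.
    have h2 : c • (1 + E) = 1 := by
      apply (h.posDef.isUnit).mul_left_cancel
      rw [mul_smul_comm, Matrix.mul_add, Matrix.mul_one, h1]
    have h3 : E = (c⁻¹ - 1) • (1 : Matrix (Fin m) (Fin m) ℝ) := by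
      have h4 := congrArg (fun M => c⁻¹ • M) h2
      simp only [smul_smul, inv_mul_cancel₀ hc.ne', one_smul] at h4
      rw [sub_smul, one_smul, ← h4]; abel
    have h5 := hs.idem_right
    rw [h3, smul_mul_assoc, one_mul, smul_smul] at h5
    rcases eq_or_ne (c⁻¹ - 1) 0 with h6 | h6
    · exact hE0 (by rw [h3, h6, zero_smul])
    · have h7 := congrArg (fun M => (c⁻¹ - 1)⁻¹ • M) h5
      simp only [smul_smul, inv_mul_cancel₀ h6, inv_mul_cancel_left₀ h6, one_smul] at h7
      exact hE1 (h3.trans h7)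
  · rw [synthesis_feedbackCost_smul _ _ hc, synthesis_feedbackCost, synthesis_feedbackCost,
      hs.synthesis_add_eq]

/-- Two distinct canonical costs with the same synthesis yield a product structure. -/
theorem hasProductStructure_of_ne (hB : Function.Injective B.mulVec) (hAB : IsKalman A B)
    (h : IsCanonicalPair A B R K) (h' : IsCanonicalPair A B R' K')
    (hs : synthesis A B (feedbackCost R K) = synthesis A B (feedbackCost R' K'))
    (hne : feedbackCost R K ≠ feedbackCost R' K') : HasProductStructure A B R K := by
  have hF := (isAsymptoticallyStable_iff _).mp h.stable
  have hF' := (isAsymptoticallyStable_iff _).mp h'.stable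
  have hFB := hAB.sub_mul K
  obtain ⟨G, W, hd⟩ := exists_isDual h.posDef hF hFB
  obtain ⟨G', W', hd'⟩ := exists_isDual h'.posDef hF' (hAB.sub_mul K')
  obtain ⟨hFF, rfl⟩ := closedLoop_eq_of_synthesis_eq h.posDef h'.posDef hF hF' hd hd' hs
  have hKK : K = K' := mul_left_cancel_of_injective hB (sub_right_injective hFF)
  subst hKK
  have hRt := transpose_eq_of_posDef h.posDef
  have hRt' := transpose_eq_of_posDef h'.posDef
  have hRi : R⁻¹ᵀ = R⁻¹ := transpose_eq_of_posDef h.posDef.inv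
  have hRi' : R'⁻¹ᵀ = R'⁻¹ := transpose_eq_of_posDef h'.posDef.inv
  have hRu := isUnit_det_of_posDef h.posDef
  have hRu' := isUnit_det_of_posDef h'.posDef
  -- If `R = s R'`, the determinants give `s ^ m = 1`, positive definiteness gives `s ≥ 0`, and so
  -- `s = 1`.
  have hns : ∀ s : ℝ, R'⁻¹ * R ≠ s • 1 := by
    intro s hs
    apply hne
    have h1 : R = s • R' := by
      have := congrArg (fun M => R' * M) hs
      simpa [Matrix.mul_nonsing_inv_cancel_left _ _ hRu'] using this
    rcases Nat.eq_zero_or_pos m with rfl | hm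
    · rw [Subsingleton.elim R R']
    · have h2 := h.det_eq_one
      rw [h1, Matrix.det_smul, Fintype.card_fin, h'.det_eq_one, mul_one] at h2
      have h3 : 0 ≤ s := by
        have p1 := h.posDef.diag_pos (i := ⟨0, hm⟩)
        have p2 := h'.posDef.diag_pos (i := ⟨0, hm⟩)
        rw [h1, Matrix.smul_apply, smul_eq_mul] at p1
        exact ((pos_iff_pos_of_mul_pos p1).mpr p2).le
      rw [(pow_eq_one_iff_of_nonneg h3 hm.ne').mp h2, one_smul] at h1
      rw [h1]
  obtain ⟨T, μ, hT, hΔ⟩ := exists_diagonalization hRt h'.posDef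
  obtain ⟨f, hf, hf0, hf1⟩ := exists_aeval_idempotent hT hΔ hns
  -- Both sides become `G - F` after multiplication by the injective `B`. The transpose of this
  -- identity yields `D B = B Δ`.
  have hJ : R⁻¹ * Bᵀ * W⁻¹ = R'⁻¹ * Bᵀ * W'⁻¹ := by
    apply mul_left_cancel_of_injective hB
    simp only [← Matrix.mul_assoc]
    rw [hd.sub_eq, hd'.sub_eq]
  have hWi : W⁻¹ᵀ = W⁻¹ := by rw [Matrix.transpose_nonsing_inv, hd.symm]
  have hWi' : W'⁻¹ᵀ = W'⁻¹ := by rw [Matrix.transpose_nonsing_inv, hd'.symm]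
  have hJt : W⁻¹ * B * R⁻¹ = W'⁻¹ * B * R'⁻¹ := by
    have := congrArg Matrix.transpose hJ
    simp only [Matrix.transpose_mul, hWi, hWi', hRi, hRi', Matrix.transpose_transpose] at this
    simpa only [Matrix.mul_assoc] using this
  have hDB : W' * W⁻¹ * B = B * (R'⁻¹ * R) := by
    calc W' * W⁻¹ * B = W' * (W⁻¹ * B * R⁻¹) * R := by
          rw [Matrix.mul_assoc _ _ R, Matrix.mul_assoc _ R⁻¹, Matrix.nonsing_inv_mul _ hRu,
            Matrix.mul_one, Matrix.mul_assoc]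
      _ = W' * W'⁻¹ * B * (R'⁻¹ * R) := by rw [hJt]; simp only [Matrix.mul_assoc]
      _ = _ := by rw [Matrix.mul_nonsing_inv _ hd'.isUnit, Matrix.one_mul]
  have hDG : W' * W⁻¹ * G = G * (W' * W⁻¹) := by
    rw [← Matrix.mul_assoc, hd'.conj, Matrix.mul_assoc, Matrix.mul_assoc, hd.inv_mul, Matrix.neg_mul]
  have hFG : A - B * K = G - B * (R⁻¹ * Bᵀ * W⁻¹) := by
    rw [hd.eq]; simp only [Matrix.mul_assoc]; abel
  have hDF : W' * W⁻¹ * (A - B * K) = (A - B * K) * (W' * W⁻¹) := by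
    have e1 : W' * W⁻¹ * (B * (R⁻¹ * Bᵀ * W⁻¹)) = B * R'⁻¹ * Bᵀ * W⁻¹ := by
      rw [← Matrix.mul_assoc, hDB]
      simp only [Matrix.mul_assoc, Matrix.mul_nonsing_inv_cancel_left _ _ hRu]
    have e2 : B * (R⁻¹ * Bᵀ * W⁻¹) * (W' * W⁻¹) = B * R'⁻¹ * Bᵀ * W⁻¹ := by
      rw [hJ]
      simp only [Matrix.mul_assoc, Matrix.nonsing_inv_mul_cancel_left _ _ hd'.isUnit]
    rw [hFG, Matrix.mul_sub, Matrix.sub_mul, hDG, e1, e2]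
  have hΔR : (R'⁻¹ * R)ᵀ * R = R * (R'⁻¹ * R) := by
    rw [Matrix.transpose_mul, hRi', hRt, Matrix.mul_assoc]
  -- `(f² - f)(D)` commutes with `F` and `(f² - f)(D) B = B (f² - f)(Δ) = 0`, so controllability
  -- applies; `D` itself need not be diagonalized.
  have hfD : aeval (W' * W⁻¹) (f * f - f) = 0 := by
    apply hFB.eq_zero_of_mul_eq_zero (aeval_mul_comm_of_comm hDF _)
    rw [aeval_mul_comm_of_comm hDB, hf, Matrix.mul_zero]
  have hsp : IsSplitting (A - B * K) B R (aeval (W' * W⁻¹) f) (aeval (R'⁻¹ * R) f) :=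
    { idem_left := by rwa [map_sub, map_mul, sub_eq_zero] at hfD
      idem_right := by rwa [map_sub, map_mul, sub_eq_zero] at hf
      comm := aeval_mul_comm_of_comm hDF f
      intertwine := aeval_mul_comm_of_comm hDB f
      symm := by rw [← aeval_transpose, aeval_mul_comm_of_comm hΔR] }
  exact hsp.hasProductStructure hf0 hf1 h.posDef hB hFB

end Canonical

end LQ

theorem mainTheorem7 {n m : ℕ} (A : Matrix (Fin n) (Fin n) ℝ) (B : Matrix (Fin n) (Fin m) ℝ)
    (hB : B.rank = m) (hAB : LQ.IsKalman A B)
    (Γ : Set (ℝ × ℝ × (ℝ → Fin n → ℝ))) (hΓ : LQ.IsLQSynthesis A B Γ) :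
    (∃! c : (Fin n → ℝ) → (Fin m → ℝ) → ℝ,
        LQ.IsCanonicalCost A B c ∧ LQ.synthesis A B c = Γ) ↔
      ¬ ∃ (R : Matrix (Fin m) (Fin m) ℝ) (K : Matrix (Fin m) (Fin n) ℝ),
        LQ.IsCanonicalPair A B R K ∧ LQ.synthesis A B (LQ.feedbackCost R K) = Γ ∧
          LQ.HasProductStructure A B R K := by
  constructor
  · rintro ⟨c, -, hu⟩ ⟨R, K, hRK, hs, hp⟩
    obtain ⟨R', hR', hne, hs'⟩ := LQ.exists_ne_of_hasProductStructure hRK hp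
    exact hne ((hu _ ⟨⟨R', K, hR', rfl⟩, hs'.trans hs⟩).trans
      (hu _ ⟨⟨R, K, hRK, rfl⟩, hs⟩).symm)
  · intro hno
    obtain ⟨R, K, hRK, hs⟩ := LQ.exists_canonicalPair hAB hΓ
    refine ⟨LQ.feedbackCost R K, ⟨⟨R, K, hRK, rfl⟩, hs⟩, ?_⟩
    rintro _ ⟨⟨R', K', hRK', rfl⟩, hs'⟩
    by_contra hne
    exact hno ⟨R', K', hRK', hs', LQ.hasProductStructure_of_ne (LQ.mulVec_injective_of_rank hB)
      hAB hRK' hRK (hs'.trans hs.symm) hne⟩
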